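/- Let $b,c\in C[0,1]$, $\lambda,a_1,a_2,a_3,a_4\in C([0,1]^2)$ be non-negative and let $\phi\in C[0,1]$. For each $N\ge 1$ let $\{X_t^N\}_{t\ge0}$ be the $N$-urn linear system, that is, the continuous-time Markov process with state space $[0,+\infty)^N$ and generator $$\mathcal L_Nf(x)=\sum_{i=1}^N b\left(\tfrac iN\right)\left(f(x^{i,+})-f(x)\right)+\frac1N\sum_{i=1}^N\sum_{j\ne i}\lambda\left(\tfrac iN,\tfrac jN\right)\left(f(x^{(i,j)})-f(x)\right),$$ where $x^{i,+}$ is obtained from $x$ by replacing $x(i)$ with $c(\frac iN)x(i)$, and $x^{(i,j)}$ is obtained from $x$ by replacing $x(i)$ with $a_1(\frac iN,\frac jN)x(i)+a_2(\frac iN,\frac jN)x(j)$ and $x(j)$ with $a_3(\frac iN,\frac jN)x(i)+a_4(\frac iN,\frac jN)x(j)$. Assume that $X_0^N(1),\dots,X_0^N(N)$ are independent and $P(X_0^N(i)=1)=\phi(\frac iN)=1-P(X_0^N(i)=0)$ for $1\le i\le N$. Let $\{\rho(t,\cdot)\}_{t\ge0}$ be the unique solution of the $C[0,1]$-valued ordinary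 differential equation (with respect to $\|\cdot\|_\infty$) $$\begin{aligned}\frac{d}{dt}\rho(t,u)={}&b(u)(c(u)-1)\rho(t,u)+\rho(t,u)\int_0^1\lambda(v,u)(a_4(v,u)-1)\,dv+\rho(t,u)\int_0^1\lambda(u,v)(a_1(u,v)-1)\,dv\\&+\int_0^1\lambda(u,v)a_2(u,v)\rho(t,v)\,dv+\int_0^1\lambda(v,u)a_3(v,u)\rho(t,v)\,dv,\qquad \rho(0,\cdot)=\phi.\end{aligned}$$ Define the pair empirical measure $\omega_t^N=\frac1{N^2}\sum_{i=1}^N\sum_{j=1}^N X_t^N(i)X_t^N(j)\,\delta_{(i/N,\,j/N)}$ on $[0,1]^2$, and write $H_t=H(t,\cdot,\cdot)$. **Lemma.** For every $T>0$ and every $H\in C([0,T]\times[0,1]\times[0,1])$, $$\lim_{N\to+\infty}\ \sup_{0\le t\le T}\ \mathbb E\left[\left(\omega_t^N(H_t)-\int_0^1\int_0^1\rho(t,u)\rho(t,v)H_t(u,v)\,du\,dv\right)^2\right]=0 .$$ -/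

import Mathlib

open MeasureTheory Filter Topology
open scoped NNReal ENNReal unitInterval

noncomputable section

namespace UrnSystem

/-- The coefficient functions of the family of `N`-urn linear systems: non-negative continuous
functions on `[0,1]` and on `[0,1]²`. -/
structure Coeffs where
  (b c : C(I, ℝ≥0))
  (lam a₁ a₂ a₃ a₄ : C(I × I, ℝ≥0))

/-- The position `i / N ∈ [0,1]` of the `i`-th urn. The urns `1, …, N` are labelled by `Fin N`,
so that `i : Fin N` stands for the urn with number `i + 1`. -/
def site {N : ℕ} (i : Fin N) : I :=
  ⟨((i : ℕ) + 1 : ℝ) / N, by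
    have h : ((i : ℕ) + 1 : ℝ) ≤ N := by exact_mod_cast i.isLt
    exact ⟨by positivity, div_le_one_of_le₀ h (Nat.cast_nonneg N)⟩⟩

variable (p : Coeffs)

/-- The configuration `x^{i,+}`: the `i`-th coordinate is multiplied by `c(i/N)`. -/
def singleJump {N : ℕ} (i : Fin N) (x : Fin N → ℝ≥0) : Fin N → ℝ≥0 :=
  Function.update x i (p.c (site i) * x i)

/-- The configuration `x^{(i,j)}` (used only for `i ≠ j`). -/
def pairJump {N : ℕ} (i j : Fin N) (x : Fin N → ℝ≥0) : Fin N → ℝ≥0 := fun k =>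
  if k = i then p.a₁ (site i, site j) * x i + p.a₂ (site i, site j) * x j
  else if k = j then p.a₃ (site i, site j) * x i + p.a₄ (site i, site j) * x j
  else x k

/-- The generator of the `N`-urn linear system, which encodes its transition rates. -/
def generator (N : ℕ) (f : (Fin N → ℝ≥0) → ℝ) : (Fin N → ℝ≥0) → ℝ := fun x =>
  (∑ i : Fin N, (p.b (site i) : ℝ) * (f (singleJump p i x) - f x)) +
    (1 / (N : ℝ)) * ∑ i : Fin N, ∑ j ∈ Finset.univ.erase i,
      (p.lam (site i, site j) : ℝ) * (f (pairJump p i j x) - f x)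

/-- The Markov semigroup `S(t) f = e^{t L} f = ∑ₖ tᵏ/k! Lᵏ f` with generator `L`. The total jump
rate out of a configuration does not depend on the configuration, so `L` is bounded in the
supremum norm and the series converges absolutely, uniformly in `x`, for every bounded `f`. -/
def semigroup (N : ℕ) (t : ℝ≥0) (f : (Fin N → ℝ≥0) → ℝ) : (Fin N → ℝ≥0) → ℝ := fun x =>
  ∑' k : ℕ, ((t : ℝ) ^ k / (k.factorial : ℝ)) * ((generator p N)^[k] f) x

/-- The σ-algebra generated by the process up to time `s`. -/
abbrev history {Ω S : Type*} [MeasurableSpace S] (X : ℝ≥0 → Ω → S) (s : ℝ≥0) : MeasurableSpace Ω :=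
  ⨆ r : Set.Iic s, MeasurableSpace.comap (X r) inferInstance

/-- `X` is an `N`-urn linear system under `P`: a Markov process with state space `[0,∞)^N`, with
respect to its own history, whose transition semigroup is the one with the above generator. -/
structure IsUrnLinearSystem (N : ℕ) {Ω : Type*} [MeasurableSpace Ω] (P : Measure Ω)
    (X : ℝ≥0 → Ω → (Fin N → ℝ≥0)) : Prop where
  measurable : ∀ t, Measurable (X t)
  markov : ∀ (s t : ℝ≥0) (f : (Fin N → ℝ≥0) → ℝ), Measurable f → (∃ C : ℝ, ∀ x, |f x| ≤ C) →
    P[fun ω => f (X (s + t) ω) | history X s] =ᵐ[P] fun ω => semigroup p N t f (X s ω)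

/-- The initial assumption: the coordinates of `x₀` are independent, and the `i`-th one is `1`
with probability `φ(i/N)` and `0` with probability `1 - φ(i/N)`. -/
structure InitialAssumption (φ : C(I, ℝ)) (N : ℕ) {Ω : Type*} [MeasurableSpace Ω] (P : Measure Ω)
    (x₀ : Ω → (Fin N → ℝ≥0)) : Prop where
  indep : ProbabilityTheory.iIndepFun (fun (i : Fin N) (ω : Ω) => x₀ ω i) P
  prob_one : ∀ i, P.real {ω | x₀ ω i = 1} = φ (site i)
  prob_zero : ∀ i, P.real {ω | x₀ ω i = 0} = 1 - φ (site i)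

theorem continuous_integral_right {F : I → I → ℝ} (hF : Continuous (Function.uncurry F)) :
    Continuous fun u => ∫ v : I, F u v := by
  simpa using continuous_parametric_integral_of_continuous (μ := (volume : Measure I)) hF
    isCompact_univ

/-- The linear operator on `C[0,1]` that drives the hydrodynamic equation for the density. -/
def densityOp (f : C(I, ℝ)) : C(I, ℝ) where
  toFun u :=
    (p.b u : ℝ) * ((p.c u : ℝ) - 1) * f u
      + f u * (∫ v : I, (p.lam (v, u) : ℝ) * ((p.a₄ (v, u) : ℝ) - 1))
      + f u * (∫ v : I, (p.lam (u, v) : ℝ) * ((p.a₁ (u, v) : ℝ) - 1))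
      + (∫ v : I, (p.lam (u, v) : ℝ) * (p.a₂ (u, v) : ℝ) * f v)
      + (∫ v : I, (p.lam (v, u) : ℝ) * (p.a₃ (v, u) : ℝ) * f v)
  continuous_toFun := by
    have h₁ := continuous_integral_right
      (F := fun u v => (p.lam (v, u) : ℝ) * ((p.a₄ (v, u) : ℝ) - 1)) (by fun_prop)
    have h₂ := continuous_integral_right
      (F := fun u v => (p.lam (u, v) : ℝ) * ((p.a₁ (u, v) : ℝ) - 1)) (by fun_prop)
    have h₃ := continuous_integral_right
      (F := fun u v => (p.lam (u, v) : ℝ) * (p.a₂ (u, v) : ℝ) * f v) (by fun_prop)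
    have h₄ := continuous_integral_right
      (F := fun u v => (p.lam (v, u) : ℝ) * (p.a₃ (v, u) : ℝ) * f v) (by fun_prop)
    fun_prop

/-- `ρ` solves the `C[0,1]`-valued linear differential equation `dρ/dt = densityOp ρ` for `t ≥ 0`,
`ρ(0) = φ`, in the supremum norm (one-sided derivative at `t = 0`; values at `t < 0` are
irrelevant). -/
structure IsHydrodynamicDensity (φ : C(I, ℝ)) (ρ : ℝ → C(I, ℝ)) : Prop where
  initial : ρ 0 = φ
  deriv : ∀ t : ℝ, 0 ≤ t → HasDerivWithinAt ρ (densityOp p (ρ t)) (Set.Ici 0) t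

/-- The pair empirical measure `N⁻² ∑ᵢ ∑ⱼ x(i) x(j) δ_{(i/N, j/N)}` of a configuration `x`. -/
def pairEmpirical {N : ℕ} (x : Fin N → ℝ≥0) : Measure (I × I) :=
  ((N : ℝ≥0) ^ 2)⁻¹ • ∑ i : Fin N, ∑ j : Fin N, (x i * x j) • Measure.dirac (site i, site j)

end UrnSystem

end

/-!
Each jump is linear in the configuration and changes at most two urns, so the generator applied to
`∏_{k ∈ s} x(k)` is a combination of such products over sets of size `|s|`, up to a term of order
`1/N` from the jumps between two urns of `s`. The products `∏_{k ∈ s} ρ(t, k/N)` satisfy the same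
linear system up to a Riemann sum error, and agree with the correlations at time `0` by
independence, so Grönwall's inequality shows that `E[∏_{k ∈ s} X_t(k)] - ∏_{k ∈ s} ρ(t, k/N)` tends
to `0`, uniformly in `t ≤ T` and in the sets `s` of a given size. Now `ω_t(H_t)` is an average of
products of two coordinates and its square is an average of products of four; tuples with
coinciding indices have vanishing weight, and moments stay bounded. Hence the first two moments of
`ω_t(H_t)` are asymptotically those of the deterministic value obtained by replacing `X_t(k)` with
`ρ(t, k/N)`.

The Markov property only speaks about bounded functions; the forward equation for products of
coordinates follows by truncation, with powers of the coordinates as Lyapunov functions.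
-/

namespace UrnSystem

section Gronwall

variable {E : Type*} [NormedAddCommGroup E] [NormedSpace ℝ E]

theorem norm_le_gronwallBound {f f' : ℝ → E} {δ C ε T : ℝ}
    (hf : ∀ t, 0 ≤ t → HasDerivWithinAt f (f' t) (Set.Ici 0) t) (h₀ : ‖f 0‖ ≤ δ)
    (bound : ∀ t ∈ Set.Ico 0 T, ‖f' t‖ ≤ C * ‖f t‖ + ε) {t : ℝ} (ht : t ∈ Set.Icc 0 T) :
    ‖f t‖ ≤ gronwallBound δ C ε t := by
  simpa using norm_le_gronwallBound_of_norm_deriv_right_le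
    (fun s hs => (hf s hs.1).continuousWithinAt.mono Set.Icc_subset_Ici_self)
    (fun s hs => (hf s hs.1).mono (Set.Ici_subset_Ici.2 hs.1)) h₀ bound t ht

end Gronwall

/-- The exponential series `∑ₖ tᵏ/k! aₖ`; its sum is only meaningful when the series converges. -/
noncomputable def expSeries (a : ℕ → ℝ) (t : ℝ) : ℝ :=
  ∑' k : ℕ, t ^ k / (k.factorial : ℝ) * a k

section ExpSeries

variable {a : ℕ → ℝ} {K R : ℝ}

theorem abs_expSeries_term_le (ha : ∀ k, |a k| ≤ K * R ^ k) (t : ℝ) (k : ℕ) :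
    |t ^ k / (k.factorial : ℝ) * a k| ≤ K * ((|t| * R) ^ k / (k.factorial : ℝ)) := by
  rw [abs_mul, abs_div, abs_pow, Nat.abs_cast]
  calc |t| ^ k / (k.factorial : ℝ) * |a k| ≤ |t| ^ k / (k.factorial : ℝ) * (K * R ^ k) :=
        mul_le_mul_of_nonneg_left (ha k) (by positivity)
    _ = _ := by ring

theorem summable_expSeries (ha : ∀ k, |a k| ≤ K * R ^ k) (t : ℝ) :
    Summable fun k : ℕ => t ^ k / (k.factorial : ℝ) * a k :=
  .of_norm_bounded ((Real.summable_pow_div_factorial _).mul_left K) (abs_expSeries_term_le ha t)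

theorem abs_expSeries_le (ha : ∀ k, |a k| ≤ K * R ^ k) (t : ℝ) :
    |expSeries a t| ≤ ∑' k : ℕ, K * ((|t| * R) ^ k / (k.factorial : ℝ)) :=
  tsum_of_norm_bounded (f := fun k => t ^ k / (k.factorial : ℝ) * a k)
    ((Real.summable_pow_div_factorial (|t| * R)).mul_left K).hasSum (abs_expSeries_term_le ha t)

theorem tendsto_expSeries {A : ℕ → ℕ → ℝ} (hA : ∀ n k, |A n k| ≤ K * R ^ k)
    (h : ∀ k, Tendsto (fun n => A n k) atTop (𝓝 (a k))) (t : ℝ) :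
    Tendsto (fun n => expSeries (A n) t) atTop (𝓝 (expSeries a t)) :=
  tendsto_tsum_of_dominated_convergence ((Real.summable_pow_div_factorial (|t| * R)).mul_left K)
    (fun k => (h k).const_mul _) (.of_forall fun n => abs_expSeries_term_le (hA n) t)

theorem hasDerivAt_pow_div_factorial (k : ℕ) (t : ℝ) :
    HasDerivAt (fun s : ℝ => s ^ (k + 1) / ((k + 1).factorial : ℝ)) (t ^ k / (k.factorial : ℝ))
      t := by
  simp only [Nat.factorial_succ, Nat.cast_mul]
  simpa [mul_div_mul_left _ _ (Nat.cast_add_one_ne_zero (R := ℝ) k)] using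
    (hasDerivAt_pow (k + 1) t).div_const ((k + 1 : ℕ) * k.factorial : ℝ)

theorem hasDerivAt_expSeries (ha : ∀ k, |a k| ≤ K * R ^ k) (t : ℝ) :
    HasDerivAt (expSeries a) (expSeries (fun k => a (k + 1)) t) t := by
  have ha' : ∀ k, |a (k + 1)| ≤ (K * R) * R ^ k := fun k => (ha (k + 1)).trans_eq (by ring)
  have hsplit : expSeries a = fun s =>
      a 0 + ∑' k : ℕ, s ^ (k + 1) / ((k + 1).factorial : ℝ) * a (k + 1) := by
    ext s
    simpa [expSeries] using (summable_expSeries ha s).tsum_eq_zero_add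
  rw [hsplit]
  refine HasDerivAt.const_add _ ?_
  refine hasDerivAt_tsum_of_isPreconnected (summable_expSeries ha' (|t| + 1)).abs
    Metric.isOpen_ball (convex_ball (0 : ℝ) (|t| + 1)).isPreconnected
    (fun k s _ => (hasDerivAt_pow_div_factorial k s).mul_const _) (fun k s hs => ?_)
    (Metric.mem_ball_self (by positivity)) ?_ (by simp)
  · have hs' : |s| ≤ |t| + 1 := by simpa using (Metric.mem_ball.1 hs).le
    rw [Real.norm_eq_abs, abs_mul, abs_mul, abs_div, abs_div, abs_pow, abs_pow,
      abs_of_nonneg (by positivity : 0 ≤ |t| + 1)]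
    gcongr
  · exact (summable_nat_add_iff 1).2 (summable_expSeries ha 0)

end ExpSeries

section Generator

variable {p : Coeffs} {N : ℕ}

/-- The total jump rate of the `N`-urn system, which does not depend on the configuration. -/
noncomputable def totalRate (p : Coeffs) (N : ℕ) : ℝ :=
  (∑ i : Fin N, (p.b (site i) : ℝ)) +
    (1 / (N : ℝ)) * ∑ i : Fin N, ∑ j ∈ Finset.univ.erase i, (p.lam (site i, site j) : ℝ)

theorem abs_generator_le_of_jump {f : (Fin N → ℝ≥0) → ℝ} {x : Fin N → ℝ≥0} {B : ℝ}
    (hs : ∀ i, |f (singleJump p i x) - f x| ≤ B) (hp : ∀ i j, |f (pairJump p i j x) - f x| ≤ B) :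
    |generator p N f x| ≤ totalRate p N * B := by
  have hmul : ∀ (r : ℝ≥0) (y : ℝ), |y| ≤ B → |r * y| ≤ r * B := fun r y hy => by
    rw [abs_mul, NNReal.abs_eq]
    exact mul_le_mul_of_nonneg_left hy r.2
  unfold generator totalRate
  simp only [add_mul, mul_assoc, Finset.sum_mul]
  refine (abs_add_le _ _).trans (add_le_add ?_ ?_)
  · exact (Finset.abs_sum_le_sum_abs _ _).trans (Finset.sum_le_sum fun i _ => hmul _ _ (hs i))
  · rw [abs_mul, abs_of_nonneg (by positivity : (0 : ℝ) ≤ 1 / N)]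
    refine mul_le_mul_of_nonneg_left ?_ (by positivity)
    refine (Finset.abs_sum_le_sum_abs _ _).trans (Finset.sum_le_sum fun i _ => ?_)
    exact (Finset.abs_sum_le_sum_abs _ _).trans (Finset.sum_le_sum fun j _ => hmul _ _ (hp i j))

theorem measurable_singleJump (i : Fin N) : Measurable (singleJump p i) :=
  (measurable_update' (a := i)).comp
    (measurable_id.prodMk (measurable_const.mul (measurable_pi_apply i)))

theorem measurable_pairJump (i j : Fin N) : Measurable (pairJump p i j) := by
  refine measurable_pi_iff.2 fun k => ?_
  unfold pairJump
  split_ifs <;> fun_prop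

theorem measurable_generator {f : (Fin N → ℝ≥0) → ℝ} (hf : Measurable f) :
    Measurable (generator p N f) := by
  have hs := fun i : Fin N => hf.comp (measurable_singleJump (p := p) i)
  have hp := fun i j : Fin N => hf.comp (measurable_pairJump (p := p) i j)
  exact (Finset.measurable_sum _ fun i _ => ((hs i).sub hf).const_mul _).add
    (.const_mul (Finset.measurable_sum _ fun i _ => Finset.measurable_sum _ fun j _ =>
      ((hp i j).sub hf).const_mul _) _)

theorem measurable_iterate_generator {f : (Fin N → ℝ≥0) → ℝ} (hf : Measurable f) (k : ℕ) :
    Measurable ((generator p N)^[k] f) := by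
  induction k with
  | zero => exact hf
  | succ k ih =>
    rw [Function.iterate_succ_apply']
    exact measurable_generator ih

theorem tendsto_generator {f : ℕ → (Fin N → ℝ≥0) → ℝ} {g : (Fin N → ℝ≥0) → ℝ}
    (h : ∀ x, Tendsto (fun n => f n x) atTop (𝓝 (g x))) (x : Fin N → ℝ≥0) :
    Tendsto (fun n => generator p N (f n) x) atTop (𝓝 (generator p N g x)) :=
  .add (tendsto_finsetSum _ fun _ _ => ((h _).sub (h _)).const_mul _)
    (.const_mul _ (tendsto_finsetSum _ fun _ _ => tendsto_finsetSum _ fun _ _ =>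
      ((h _).sub (h _)).const_mul _))

theorem tendsto_iterate_generator {f : ℕ → (Fin N → ℝ≥0) → ℝ} {g : (Fin N → ℝ≥0) → ℝ}
    (h : ∀ x, Tendsto (fun n => f n x) atTop (𝓝 (g x))) (k : ℕ) (x : Fin N → ℝ≥0) :
    Tendsto (fun n => (generator p N)^[k] (f n) x) atTop (𝓝 ((generator p N)^[k] g x)) := by
  induction k generalizing x with
  | zero => exact h x
  | succ k ih =>
    simp only [Function.iterate_succ_apply']
    exact tendsto_generator ih x

/-- A measurable weight `W ≥ 1` on configurations that a jump increases at most by the factor `D`.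
Functions dominated by such a weight stay so under the generator. -/
structure IsJumpWeight (p : Coeffs) (W : (Fin N → ℝ≥0) → ℝ) (D : ℝ) : Prop where
  measurable : Measurable W
  one_le : ∀ x, 1 ≤ W x
  single : ∀ i x, W (singleJump p i x) ≤ D * W x
  pair : ∀ i j x, W (pairJump p i j x) ≤ D * W x

theorem isJumpWeight_one : IsJumpWeight p (N := N) (fun _ => 1) 1 :=
  ⟨measurable_const, fun _ => le_rfl, fun _ _ => by simp, fun _ _ _ => by simp⟩

namespace IsJumpWeight

variable {W f : (Fin N → ℝ≥0) → ℝ} {D K : ℝ}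

theorem nonneg_of_abs_le (hW : IsJumpWeight p W D) (hf : ∀ x, |f x| ≤ K * W x) : 0 ≤ K :=
  nonneg_of_mul_nonneg_left ((abs_nonneg _).trans (hf 0)) (zero_lt_one.trans_le (hW.one_le 0))

theorem abs_generator_le (hW : IsJumpWeight p W D) (hf : ∀ x, |f x| ≤ K * W x)
    (x : Fin N → ℝ≥0) : |generator p N f x| ≤ K * (totalRate p N * (D + 1)) * W x := by
  have hK := hW.nonneg_of_abs_le hf
  have hjump : ∀ y, W y ≤ D * W x → |f y - f x| ≤ K * (D + 1) * W x := fun y hy =>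
    calc |f y - f x| ≤ |f y| + |f x| := abs_sub _ _
      _ ≤ K * W y + K * W x := add_le_add (hf y) (hf x)
      _ ≤ K * (D * W x) + K * W x := by gcongr
      _ = _ := by ring
  exact (abs_generator_le_of_jump (fun i => hjump _ (hW.single i x))
    (fun i j => hjump _ (hW.pair i j x))).trans_eq (by ring)

theorem abs_iterate_generator_le (hW : IsJumpWeight p W D) (hf : ∀ x, |f x| ≤ K * W x) (k : ℕ)
    (x : Fin N → ℝ≥0) :
    |(generator p N)^[k] f x| ≤ K * (totalRate p N * (D + 1)) ^ k * W x := by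
  induction k generalizing x with
  | zero => simpa using hf x
  | succ k ih =>
    rw [Function.iterate_succ_apply', pow_succ, ← mul_assoc]
    exact hW.abs_generator_le ih x

end IsJumpWeight

end Generator

section ForwardEquation

variable {p : Coeffs} {N : ℕ} {Ω : Type*} [MeasurableSpace Ω] {P : Measure Ω}
  {X : ℝ≥0 → Ω → (Fin N → ℝ≥0)} {f W : (Fin N → ℝ≥0) → ℝ} {D K : ℝ}

theorem integrable_of_tendsto_of_integral_norm_le {G : ℕ → Ω → ℝ} {g : Ω → ℝ} {B : ℝ}
    (hG : ∀ n, Integrable (G n) P) (hB : ∀ n, ∫ ω, ‖G n ω‖ ∂P ≤ B)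
    (h : ∀ ω, Tendsto (fun n => G n ω) atTop (𝓝 (g ω))) : Integrable g P := by
  refine ⟨aestronglyMeasurable_of_tendsto_ae atTop (fun n => (hG n).aestronglyMeasurable)
    (ae_of_all _ h), ?_⟩
  calc ∫⁻ ω, ‖g ω‖ₑ ∂P = ∫⁻ ω, liminf (fun n => ‖G n ω‖ₑ) atTop ∂P :=
        lintegral_congr fun ω => (h ω).enorm.liminf_eq.symm
    _ ≤ liminf (fun n => ∫⁻ ω, ‖G n ω‖ₑ ∂P) atTop :=
        lintegral_liminf_le' fun n => (hG n).aestronglyMeasurable.enorm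
    _ ≤ ENNReal.ofReal B := by
        refine liminf_le_of_frequently_le' (.of_forall fun n => ?_)
        rw [← ofReal_integral_norm_eq_lintegral_enorm (hG n)]
        exact ENNReal.ofReal_le_ofReal (hB n)
    _ < ⊤ := ENNReal.ofReal_lt_top

theorem integrable_comp_of_abs_le {Y : Ω → (Fin N → ℝ≥0)} (hf : Measurable f)
    (hfW : ∀ x, |f x| ≤ K * W x) (hY : Measurable Y) (hW : Integrable (fun ω => W (Y ω)) P) :
    Integrable (fun ω => f (Y ω)) P :=
  (hW.const_mul K).mono' (hf.comp hY).aestronglyMeasurable (ae_of_all _ fun _ => hfW _)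

theorem abs_integral_comp_le {Y : Ω → (Fin N → ℝ≥0)} (hfW : ∀ x, |f x| ≤ K * W x)
    (hW : Integrable (fun ω => W (Y ω)) P) :
    |∫ ω, f (Y ω) ∂P| ≤ K * ∫ ω, W (Y ω) ∂P := by
  rw [← integral_const_mul]
  exact norm_integral_le_of_norm_le (f := fun ω => f (Y ω)) (hW.const_mul K)
    (ae_of_all _ fun _ => hfW _)

theorem IsJumpWeight.abs_integral_iterate_generator_le {Y : Ω → (Fin N → ℝ≥0)}
    (hW : IsJumpWeight p W D) (hfW : ∀ x, |f x| ≤ K * W x)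
    (hWY : Integrable (fun ω => W (Y ω)) P) (k : ℕ) :
    |∫ ω, (generator p N)^[k] f (Y ω) ∂P|
      ≤ K * (∫ ω, W (Y ω) ∂P) * (totalRate p N * (D + 1)) ^ k :=
  (abs_integral_comp_le (hW.abs_iterate_generator_le hfW k) hWY).trans_eq (by ring)

/-- Truncation of `f` to the configurations of weight `W` at most `M`. -/
noncomputable def truncate (W : (Fin N → ℝ≥0) → ℝ) (M : ℕ) (f : (Fin N → ℝ≥0) → ℝ) :
    (Fin N → ℝ≥0) → ℝ :=
  {x | W x ≤ M}.indicator f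

theorem measurable_truncate (hW : Measurable W) (hf : Measurable f) (M : ℕ) :
    Measurable (truncate W M f) :=
  hf.indicator (measurableSet_le hW measurable_const)

theorem abs_truncate_le (M : ℕ) (x : Fin N → ℝ≥0) : |truncate W M f x| ≤ |f x| :=
  norm_indicator_le_norm_self f x

theorem abs_truncate_le_const (hK : 0 ≤ K) (hfW : ∀ x, |f x| ≤ K * W x) (M : ℕ)
    (x : Fin N → ℝ≥0) : |truncate W M f x| ≤ K * M := by
  rw [truncate, Set.indicator_apply]
  split_ifs with hx
  · exact (hfW x).trans (mul_le_mul_of_nonneg_left hx hK)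
  · rw [abs_zero]
    positivity

theorem tendsto_truncate (x : Fin N → ℝ≥0) :
    Tendsto (fun M => truncate W M f x) atTop (𝓝 (f x)) := by
  obtain ⟨M₀, hM₀⟩ := exists_nat_ge (W x)
  refine tendsto_const_nhds.congr' ?_
  filter_upwards [eventually_ge_atTop M₀] with M hM
  exact (Set.indicator_of_mem (s := {x | W x ≤ M}) (hM₀.trans (Nat.cast_le.2 hM)) f).symm

namespace IsUrnLinearSystem

variable [IsProbabilityMeasure P]

theorem integral_eq_expSeries_of_bounded (hX : IsUrnLinearSystem p N P X) (hf : Measurable f)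
    (hK : ∀ x, |f x| ≤ K) (t : ℝ≥0) :
    ∫ ω, f (X t ω) ∂P = expSeries (fun k => ∫ ω, (generator p N)^[k] f (X 0 ω) ∂P) t := by
  have hmarkov := hX.markov 0 t f hf ⟨K, hK⟩
  rw [zero_add] at hmarkov
  rw [← integral_condExp (iSup_le fun r => (hX.measurable r).comap_le : history X 0 ≤ _),
    integral_congr_ae hmarkov]
  have hb := isJumpWeight_one.abs_iterate_generator_le (p := p) (f := f) (K := K)
    (by simpa using hK)
  set R := totalRate p N * (1 + 1)
  have hint : ∀ k, Integrable (fun ω => (generator p N)^[k] f (X 0 ω)) P := fun k =>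
    integrable_comp_of_abs_le (measurable_iterate_generator hf k) (hb k) (hX.measurable 0)
      (integrable_const _)
  have hnorm : ∀ k, |∫ ω, |(generator p N)^[k] f (X 0 ω)| ∂P| ≤ K * R ^ k := fun k =>
    (abs_integral_comp_le (f := fun x => |(generator p N)^[k] f x|) (W := fun _ => 1)
      (fun x => (abs_abs _).trans_le (hb k x)) (integrable_const _)).trans_eq (by simp)
  unfold semigroup expSeries
  rw [← integral_tsum_of_summable_integral_norm fun k => (hint k).const_mul _]
  · simp_rw [integral_const_mul]
  · refine (summable_expSeries hnorm t).congr fun k => ?_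
    rw [← integral_const_mul]
    refine integral_congr_ae (ae_of_all _ fun ω => ?_)
    simp only [norm_mul, Real.norm_eq_abs, abs_of_nonneg
      (by positivity : (0 : ℝ) ≤ (t : ℝ) ^ k / (k.factorial : ℝ))]

theorem integrable_weight (hX : IsUrnLinearSystem p N P X) (hW : IsJumpWeight p W D)
    (h₀ : Integrable (fun ω => W (X 0 ω)) P) (t : ℝ≥0) : Integrable (fun ω => W (X t ω)) P := by
  have hpos : ∀ x, 0 ≤ W x := fun x => zero_le_one.trans (hW.one_le x)
  have hWW : ∀ x, |W x| ≤ 1 * W x := fun x => by rw [one_mul, abs_of_nonneg (hpos x)]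
  have hm := measurable_truncate hW.measurable hW.measurable
  have htW : ∀ M x, |truncate W M W x| ≤ 1 * W x := fun M x =>
    (abs_truncate_le M x).trans (hWW x)
  have htM : ∀ M x, |truncate W M W x| ≤ 1 * M := abs_truncate_le_const zero_le_one hWW
  have hint : ∀ M, Integrable (fun ω => truncate W M W (X t ω)) P := fun M =>
    .of_bound ((hm M).comp (hX.measurable t)).aestronglyMeasurable _ (ae_of_all _ fun _ => htM M _)
  have hbound := fun M => calc
    ∫ ω, ‖truncate W M W (X t ω)‖ ∂P
      = ∫ ω, truncate W M W (X t ω) ∂P :=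
        integral_congr_ae (ae_of_all _ fun ω =>
          Real.norm_of_nonneg (Set.indicator_nonneg (fun x _ => hpos x) _))
    _ = expSeries (fun k => ∫ ω, (generator p N)^[k] (truncate W M W) (X 0 ω) ∂P) t :=
        hX.integral_eq_expSeries_of_bounded (hm M) (htM M) t
    _ ≤ _ := (le_abs_self _).trans
        (abs_expSeries_le (hW.abs_integral_iterate_generator_le (htW M) h₀) t)
  exact integrable_of_tendsto_of_integral_norm_le hint hbound fun _ => tendsto_truncate _

theorem integral_eq_expSeries (hX : IsUrnLinearSystem p N P X) (hW : IsJumpWeight p W D)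
    (h₀ : Integrable (fun ω => W (X 0 ω)) P) (hf : Measurable f) (hfW : ∀ x, |f x| ≤ K * W x)
    (t : ℝ≥0) :
    ∫ ω, f (X t ω) ∂P = expSeries (fun k => ∫ ω, (generator p N)^[k] f (X 0 ω) ∂P) t := by
  have hm := measurable_truncate hW.measurable hf
  have htW : ∀ M x, |truncate W M f x| ≤ K * W x := fun M x =>
    (abs_truncate_le M x).trans (hfW x)
  have hlhs : Tendsto (fun M => ∫ ω, truncate W M f (X t ω) ∂P) atTop
      (𝓝 (∫ ω, f (X t ω) ∂P)) :=
    tendsto_integral_of_dominated_convergence (fun ω => K * W (X t ω))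
      (fun M => ((hm M).comp (hX.measurable t)).aestronglyMeasurable)
      ((hX.integrable_weight hW h₀ t).const_mul K)
      (fun M => ae_of_all _ fun _ => htW M _) (ae_of_all _ fun _ => tendsto_truncate _)
  have hterm : ∀ k, Tendsto (fun M => ∫ ω, (generator p N)^[k] (truncate W M f) (X 0 ω) ∂P) atTop
      (𝓝 (∫ ω, (generator p N)^[k] f (X 0 ω) ∂P)) := fun k =>
    tendsto_integral_of_dominated_convergence
      (fun ω => K * (totalRate p N * (D + 1)) ^ k * W (X 0 ω))
      (fun M => ((measurable_iterate_generator (hm M) k).comp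
        (hX.measurable 0)).aestronglyMeasurable)
      (h₀.const_mul _) (fun M => ae_of_all _ fun _ => hW.abs_iterate_generator_le (htW M) k _)
      (ae_of_all _ fun _ => tendsto_iterate_generator tendsto_truncate k _)
  refine tendsto_nhds_unique hlhs ((tendsto_expSeries (fun M =>
    hW.abs_integral_iterate_generator_le (htW M) h₀) hterm t).congr fun M => ?_)
  exact (hX.integral_eq_expSeries_of_bounded (hm M)
    (abs_truncate_le_const (hW.nonneg_of_abs_le hfW) hfW M) t).symm

theorem hasDerivWithinAt_integral (hX : IsUrnLinearSystem p N P X) (hW : IsJumpWeight p W D)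
    (h₀ : Integrable (fun ω => W (X 0 ω)) P) (hf : Measurable f) (hfW : ∀ x, |f x| ≤ K * W x)
    {t : ℝ} (ht : 0 ≤ t) :
    HasDerivWithinAt (fun s : ℝ => ∫ ω, f (X s.toNNReal ω) ∂P)
      (∫ ω, generator p N f (X t.toNNReal ω) ∂P) (Set.Ici 0) t := by
  have hseries : ∀ s, 0 ≤ s → ∫ ω, f (X s.toNNReal ω) ∂P =
      expSeries (fun k => ∫ ω, (generator p N)^[k] f (X 0 ω) ∂P) s := fun s hs => by
    rw [hX.integral_eq_expSeries hW h₀ hf hfW, Real.coe_toNNReal s hs]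
  have hseries' : ∫ ω, generator p N f (X t.toNNReal ω) ∂P =
      expSeries (fun k => ∫ ω, (generator p N)^[k + 1] f (X 0 ω) ∂P) t := by
    rw [hX.integral_eq_expSeries hW h₀ (measurable_generator hf) (hW.abs_generator_le hfW),
      Real.coe_toNNReal t ht]
    rfl
  rw [hseries']
  exact (hasDerivAt_expSeries (hW.abs_integral_iterate_generator_le hfW h₀)
    t).hasDerivWithinAt.congr hseries (hseries t ht)

end IsUrnLinearSystem

end ForwardEquation

/-- A common bound `K ≥ 1` for all coefficient functions. -/
structure Coeffs.IsBound (p : Coeffs) (K : ℝ) : Prop where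
  one_le : 1 ≤ K
  b : ∀ u, (p.b u : ℝ) ≤ K
  c : ∀ u, (p.c u : ℝ) ≤ K
  lam : ∀ z, (p.lam z : ℝ) ≤ K
  a₁ : ∀ z, (p.a₁ z : ℝ) ≤ K
  a₂ : ∀ z, (p.a₂ z : ℝ) ≤ K
  a₃ : ∀ z, (p.a₃ z : ℝ) ≤ K
  a₄ : ∀ z, (p.a₄ z : ℝ) ≤ K

theorem eventually_forall_coe_le {Y : Type*} [TopologicalSpace Y] [CompactSpace Y]
    (f : C(Y, ℝ≥0)) : ∀ᶠ K : ℝ in atTop, ∀ y, (f y : ℝ) ≤ K := by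
  obtain ⟨B, hB⟩ := (isCompact_range (NNReal.continuous_coe.comp f.continuous)).bddAbove
  filter_upwards [eventually_ge_atTop B] with K hK y
  exact (hB ⟨y, rfl⟩).trans hK

theorem Coeffs.exists_isBound (p : Coeffs) : ∃ K, p.IsBound K := by
  obtain ⟨K, h₁, hb, hc, hlam, ha₁, ha₂, ha₃, ha₄⟩ := ((eventually_ge_atTop (1 : ℝ)).and <|
    (eventually_forall_coe_le p.b).and <| (eventually_forall_coe_le p.c).and <|
    (eventually_forall_coe_le p.lam).and <| (eventually_forall_coe_le p.a₁).and <|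
    (eventually_forall_coe_le p.a₂).and <| (eventually_forall_coe_le p.a₃).and
    (eventually_forall_coe_le p.a₄)).exists
  exact ⟨K, h₁, hb, hc, hlam, ha₁, ha₂, ha₃, ha₄⟩

section Jumps

variable {p : Coeffs} {N : ℕ} (x : Fin N → ℝ≥0)

theorem singleJump_self (i : Fin N) : singleJump p i x i = p.c (site i) * x i := by
  simp [singleJump]

theorem singleJump_of_ne {i k : Fin N} (h : k ≠ i) : singleJump p i x k = x k := by
  simp [singleJump, h]

theorem pairJump_left (i j : Fin N) : pairJump p i j x i
    = p.a₁ (site i, site j) * x i + p.a₂ (site i, site j) * x j := by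
  simp [pairJump]

theorem pairJump_right {i j : Fin N} (h : j ≠ i) : pairJump p i j x j
    = p.a₃ (site i, site j) * x i + p.a₄ (site i, site j) * x j := by
  simp [pairJump, h]

theorem pairJump_of_ne {i j k : Fin N} (h : k ≠ i) (h' : k ≠ j) : pairJump p i j x k = x k := by
  simp [pairJump, h, h']

namespace Coeffs.IsBound

variable {K : ℝ} (hK : p.IsBound K)
include hK

theorem nonneg : 0 ≤ K := zero_le_one.trans hK.one_le

theorem one_le_two_mul : 1 ≤ 2 * K := by linarith [hK.one_le]

theorem singleJump_le (i k : Fin N) : (singleJump p i x k : ℝ) ≤ 2 * K * x k := by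
  by_cases h : k = i
  · subst h
    rw [singleJump_self, NNReal.coe_mul]
    exact mul_le_mul_of_nonneg_right (by linarith [hK.c (site k), hK.nonneg]) (x k).2
  · rw [singleJump_of_ne x h]
    exact le_mul_of_one_le_left (x k).2 hK.one_le_two_mul

theorem pairJump_le_max {i j k : Fin N} (hk : k = i ∨ k = j) :
    (pairJump p i j x k : ℝ) ≤ 2 * K * max (x i : ℝ) (x j) := by
  have hmix : ∀ a a' : ℝ≥0, (a : ℝ) ≤ K → (a' : ℝ) ≤ K →
      ((a * x i + a' * x j : ℝ≥0) : ℝ) ≤ 2 * K * max (x i : ℝ) (x j) := fun a a' ha ha' =>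
    calc ((a * x i + a' * x j : ℝ≥0) : ℝ) = a * x i + a' * x j := by push_cast; rfl
      _ ≤ K * max (x i : ℝ) (x j) + K * max (x i : ℝ) (x j) :=
          add_le_add (mul_le_mul ha (le_max_left _ _) (x i).2 hK.nonneg)
            (mul_le_mul ha' (le_max_right _ _) (x j).2 hK.nonneg)
      _ = _ := by ring
  by_cases h : k = i
  · subst h
    rw [pairJump_left]
    exact hmix _ _ (hK.a₁ _) (hK.a₂ _)
  · obtain rfl := hk.resolve_left h
    rw [pairJump_right x h]
    exact hmix _ _ (hK.a₃ _) (hK.a₄ _)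

theorem le_two_mul_pow_mul {a : ℝ} (ha : 0 ≤ a) (n : ℕ) : a ≤ (2 * K) ^ n * a :=
  le_mul_of_one_le_left ha (one_le_pow₀ hK.one_le_two_mul)

theorem singleJump_pow_le (n : ℕ) (i k : Fin N) :
    (singleJump p i x k : ℝ) ^ n ≤ (2 * K) ^ n * (x k : ℝ) ^ n := by
  rw [← mul_pow]
  exact pow_le_pow_left₀ (NNReal.coe_nonneg _) (hK.singleJump_le x i k) n

theorem pairJump_pow_le_sum (n : ℕ) {s : Finset (Fin N)} {i j k : Fin N} (hi : i ∈ s) (hj : j ∈ s)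
    (hk : k ∈ s) : (pairJump p i j x k : ℝ) ^ n ≤ (2 * K) ^ n * ∑ l ∈ s, (x l : ℝ) ^ n := by
  have hle : ∀ l ∈ s, (x l : ℝ) ^ n ≤ ∑ l ∈ s, (x l : ℝ) ^ n := fun l hl =>
    Finset.single_le_sum (f := fun l => (x l : ℝ) ^ n) (fun _ _ => by positivity) hl
  by_cases h : k = i ∨ k = j
  · refine (pow_le_pow_left₀ (NNReal.coe_nonneg _) (hK.pairJump_le_max x h) n).trans ?_
    rw [mul_pow]
    refine mul_le_mul_of_nonneg_left ?_ (pow_nonneg (zero_le_one.trans hK.one_le_two_mul) n)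
    rcases max_choice (x i : ℝ) (x j) with h | h <;> rw [h]
    exacts [hle i hi, hle j hj]
  · rw [not_or] at h
    rw [pairJump_of_ne x h.1 h.2]
    exact (hle k hk).trans (hK.le_two_mul_pow_mul (by positivity) n)

end Coeffs.IsBound

end Jumps

section PowerWeight

variable {p : Coeffs} {N : ℕ}

/-- The weight `1 + ∑ₖ x(k)ⁿ`, which dominates all products of `n` coordinates. -/
noncomputable def powerWeight (n : ℕ) (x : Fin N → ℝ≥0) : ℝ := 1 + ∑ k, (x k : ℝ) ^ n

theorem Coeffs.IsBound.isJumpWeight_powerWeight {K : ℝ} (hK : p.IsBound K) (n : ℕ) :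
    IsJumpWeight p (powerWeight (N := N) n) (1 + N * (2 * K) ^ n) := by
  have hK₀ := hK.nonneg
  have key : ∀ x y : Fin N → ℝ≥0, (∀ k, (y k : ℝ) ^ n ≤ (2 * K) ^ n * ∑ l, (x l : ℝ) ^ n) →
      powerWeight n y ≤ (1 + N * (2 * K) ^ n) * powerWeight n x := fun x y h => by
    have hsum : ∑ k, (y k : ℝ) ^ n ≤ N * ((2 * K) ^ n * ∑ l, (x l : ℝ) ^ n) := by
      simpa using Finset.sum_le_sum fun k (_ : k ∈ Finset.univ) => h k
    have hpow : 0 ≤ ∑ l, (x l : ℝ) ^ n := by positivity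
    have hD : 0 ≤ N * (2 * K) ^ n := by positivity
    unfold powerWeight
    linarith
  refine ⟨by unfold powerWeight; fun_prop, fun x => ?_, fun i x => key _ _ fun k => ?_,
    fun i j x => key _ _ fun k => ?_⟩
  · exact le_add_of_nonneg_right (by positivity)
  · refine (hK.singleJump_pow_le x n i k).trans (mul_le_mul_of_nonneg_left ?_ (by positivity))
    exact Finset.single_le_sum (f := fun l => (x l : ℝ) ^ n) (fun _ _ => by positivity)
      (Finset.mem_univ k)
  · exact hK.pairJump_pow_le_sum x n (Finset.mem_univ i) (Finset.mem_univ j) (Finset.mem_univ k)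

theorem pow_le_powerWeight (n : ℕ) (x : Fin N → ℝ≥0) (k : Fin N) :
    (x k : ℝ) ^ n ≤ powerWeight n x :=
  (Finset.single_le_sum (f := fun l => (x l : ℝ) ^ n) (fun _ _ => by positivity)
    (Finset.mem_univ k)).trans (le_add_of_nonneg_left zero_le_one)

theorem integrable_powerWeight_of_le_one {Ω : Type*} [MeasurableSpace Ω] {P : Measure Ω}
    [IsProbabilityMeasure P] {x₀ : Ω → (Fin N → ℝ≥0)} (hm : Measurable x₀)
    (h₁ : ∀ᵐ ω ∂P, ∀ k, x₀ ω k ≤ 1) (n : ℕ) : Integrable (fun ω => powerWeight n (x₀ ω)) P := by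
  refine .of_bound (C := 1 + N) (Measurable.aestronglyMeasurable
    (by unfold powerWeight; fun_prop)) ?_
  filter_upwards [h₁] with ω hω
  have hsum : ∑ k, (x₀ ω k : ℝ) ^ n ≤ ∑ _ : Fin N, (1 : ℝ) :=
    Finset.sum_le_sum fun k _ => pow_le_one₀ (NNReal.coe_nonneg _) (hω k)
  rw [powerWeight, Real.norm_of_nonneg (by positivity)]
  simpa using hsum

end PowerWeight

section Moments

variable {p : Coeffs} {N : ℕ} {K : ℝ}

theorem sum_erase_decomp {ι : Type*} [Fintype ι] [DecidableEq ι] (s : Finset ι) (T : ι → ι → ℝ)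
    (hT : ∀ i j, i ∉ s → j ∉ s → T i j = 0) :
    ∑ i, ∑ j ∈ Finset.univ.erase i, T i j
      = ∑ i ∈ s, ∑ j ∈ sᶜ, (T i j + T j i) + ∑ i ∈ s, ∑ j ∈ s.erase i, T i j := by
  have hin : ∀ i ∈ s, ∑ j ∈ Finset.univ.erase i, T i j
      = ∑ j ∈ sᶜ, T i j + ∑ j ∈ s.erase i, T i j := fun i hi => by
    rw [← Finset.sum_union (Finset.disjoint_left.2 fun j h h' =>
      Finset.mem_compl.1 h (Finset.mem_of_mem_erase h'))]
    congr 1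
    grind [Finset.mem_compl]
  have hout : ∀ i ∈ sᶜ, ∑ j ∈ Finset.univ.erase i, T i j = ∑ j ∈ s, T i j := fun i hi =>
    (Finset.sum_subset (by grind [Finset.mem_compl]) fun j _ hj =>
      hT i j (Finset.mem_compl.1 hi) hj).symm
  rw [← Finset.sum_add_sum_compl s, Finset.sum_congr rfl hin, Finset.sum_congr rfl hout,
    Finset.sum_comm (s := sᶜ)]
  simp only [Finset.sum_add_distrib]
  ring

theorem generator_of_dependsOn {f : (Fin N → ℝ≥0) → ℝ} {s : Finset (Fin N)}
    (hf : DependsOn f (s : Set (Fin N))) (x : Fin N → ℝ≥0) :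
    generator p N f x
      = ∑ i ∈ s, (p.b (site i) : ℝ) * (f (singleJump p i x) - f x)
        + (1 / (N : ℝ)) * (∑ i ∈ s, ∑ j ∈ sᶜ,
            ((p.lam (site i, site j) : ℝ) * (f (pairJump p i j x) - f x)
              + (p.lam (site j, site i) : ℝ) * (f (pairJump p j i x) - f x))
          + ∑ i ∈ s, ∑ j ∈ s.erase i,
            (p.lam (site i, site j) : ℝ) * (f (pairJump p i j x) - f x)) := by
  unfold generator
  rw [sum_erase_decomp s]
  · congr 1
    refine (Finset.sum_subset (Finset.subset_univ s) fun i _ hi => ?_).symm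
    rw [hf fun k hk => singleJump_of_ne x (ne_of_mem_of_not_mem hk hi), sub_self, mul_zero]
  · intro i j hi hj
    rw [hf fun k hk => pairJump_of_ne x (ne_of_mem_of_not_mem hk hi) (ne_of_mem_of_not_mem hk hj),
      sub_self, mul_zero]

namespace Coeffs.IsBound

variable (hK : p.IsBound K)
include hK

theorem abs_rate_mul_sub_le (n : ℕ) {r : ℝ≥0} {a y B : ℝ} (hr : (r : ℝ) ≤ K) (ha : 0 ≤ a)
    (hy : 0 ≤ y) (haB : a ≤ B) (hyB : y ≤ (2 * K) ^ n * B) :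
    |r * (y - a)| ≤ K * (2 * K) ^ n * B := by
  rw [abs_mul, NNReal.abs_eq, mul_assoc]
  exact mul_le_mul hr (abs_sub_le_of_nonneg_of_le hy hyB ha
    (haB.trans (hK.le_two_mul_pow_mul (ha.trans haB) n))) (abs_nonneg _) hK.nonneg

theorem abs_rate_mul_pairJump_pow_sub_le (n : ℕ) (x : Fin N → ℝ≥0) {i j k : Fin N} (hij : i ≠ j)
    (hk : k = i ∨ k = j) :
    |p.lam (site i, site j) * ((pairJump p i j x k : ℝ) ^ n - (x k : ℝ) ^ n)|
      ≤ K * (2 * K) ^ n * ((x i : ℝ) ^ n + (x j : ℝ) ^ n) := by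
  have hk' : k ∈ ({i, j} : Finset (Fin N)) := by simpa using hk
  rw [← Finset.sum_pair (f := fun l => (x l : ℝ) ^ n) hij]
  exact hK.abs_rate_mul_sub_le n (hK.lam _) (by positivity) (by positivity)
    (Finset.single_le_sum (f := fun l => (x l : ℝ) ^ n) (fun _ _ => by positivity) hk')
    (hK.pairJump_pow_le_sum x n (by simp) (by simp) hk')

theorem abs_sum_pairJump_pow_sub_le (n : ℕ) (x : Fin N → ℝ≥0) (k : Fin N) :
    |∑ j ∈ ({k} : Finset (Fin N))ᶜ,
      (p.lam (site k, site j) * ((pairJump p k j x k : ℝ) ^ n - (x k : ℝ) ^ n)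
        + p.lam (site j, site k) * ((pairJump p j k x k : ℝ) ^ n - (x k : ℝ) ^ n))|
      ≤ 2 * K * (2 * K) ^ n * (N * (x k : ℝ) ^ n + ∑ j, (x j : ℝ) ^ n) := by
  have hK₀ := hK.nonneg
  calc
    _ ≤ ∑ j ∈ ({k} : Finset (Fin N))ᶜ, 2 * K * (2 * K) ^ n * ((x k : ℝ) ^ n + (x j : ℝ) ^ n) := by
        refine (Finset.abs_sum_le_sum_abs _ _).trans (Finset.sum_le_sum fun j hj => ?_)
        have hjk : j ≠ k := by simpa using hj
        exact (abs_add_le _ _).trans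
          ((add_le_add (hK.abs_rate_mul_pairJump_pow_sub_le n x hjk.symm (.inl rfl))
            (hK.abs_rate_mul_pairJump_pow_sub_le n x hjk (.inr rfl))).trans_eq (by ring))
    _ ≤ ∑ j, 2 * K * (2 * K) ^ n * ((x k : ℝ) ^ n + (x j : ℝ) ^ n) :=
        Finset.sum_le_sum_of_subset_of_nonneg (Finset.subset_univ _) fun j _ _ => by positivity
    _ = _ := by simp [← Finset.mul_sum, Finset.sum_add_distrib]

theorem abs_generator_pow_le (n : ℕ) (k : Fin N) (x : Fin N → ℝ≥0) :
    |generator p N (fun y => (y k : ℝ) ^ n) x|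
      ≤ 3 * K * (2 * K) ^ n * ((x k : ℝ) ^ n + (1 / (N : ℝ)) * ∑ j, (x j : ℝ) ^ n) := by
  have hN : (0 : ℝ) < N := Nat.cast_pos.2 k.pos
  have hK₀ := hK.nonneg
  rw [generator_of_dependsOn (s := {k}) fun x y h => by simp only [h k (by simp)]]
  simp only [Finset.sum_singleton, Finset.erase_singleton, Finset.sum_empty, add_zero]
  have hsingle := hK.abs_rate_mul_sub_le n (hK.b (site k)) (by positivity) (by positivity) le_rfl
    (hK.singleJump_pow_le x n k k)
  have hpairs := mul_le_mul_of_nonneg_left (hK.abs_sum_pairJump_pow_sub_le n x k)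
    (by positivity : (0 : ℝ) ≤ 1 / N)
  have hmean : 0 ≤ K * (2 * K) ^ n * ((1 / (N : ℝ)) * ∑ j, (x j : ℝ) ^ n) := by positivity
  refine (abs_add_le _ _).trans ?_
  rw [abs_mul (1 / (N : ℝ)), abs_of_nonneg (by positivity : (0 : ℝ) ≤ 1 / N)]
  have hN' : 1 / (N : ℝ) * N = 1 := one_div_mul_cancel hN.ne'
  calc _ ≤ _ := add_le_add hsingle hpairs
    _ = K * (2 * K) ^ n * ((1 + 2 * (1 / (N : ℝ) * N)) * (x k : ℝ) ^ n
          + 2 * ((1 / (N : ℝ)) * ∑ j, (x j : ℝ) ^ n)) := by ring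
    _ ≤ _ := by
        rw [hN']
        linarith

end Coeffs.IsBound

namespace IsUrnLinearSystem

variable {Ω : Type*} [MeasurableSpace Ω] {P : Measure Ω} [IsProbabilityMeasure P]
  {X : ℝ≥0 → Ω → (Fin N → ℝ≥0)}

theorem integrable_powerWeight (hX : IsUrnLinearSystem p N P X)
    (h₁ : ∀ᵐ ω ∂P, ∀ k, X 0 ω k ≤ 1) (n : ℕ) (t : ℝ≥0) :
    Integrable (fun ω => powerWeight n (X t ω)) P := by
  obtain ⟨K, hK⟩ := p.exists_isBound
  exact hX.integrable_weight (hK.isJumpWeight_powerWeight n)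
    (integrable_powerWeight_of_le_one (hX.measurable 0) h₁ n) t

theorem integrable_pow (hX : IsUrnLinearSystem p N P X) (h₁ : ∀ᵐ ω ∂P, ∀ k, X 0 ω k ≤ 1)
    (n : ℕ) (t : ℝ≥0) (k : Fin N) : Integrable (fun ω => (X t ω k : ℝ) ^ n) P := by
  refine integrable_comp_of_abs_le (f := fun x => (x k : ℝ) ^ n) (K := 1) (by fun_prop)
    (fun x => ?_) (hX.measurable t) (hX.integrable_powerWeight h₁ n t)
  rw [one_mul, abs_of_nonneg (by positivity)]
  exact pow_le_powerWeight n x k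

theorem hasDerivWithinAt_integral_pow (hX : IsUrnLinearSystem p N P X)
    (h₁ : ∀ᵐ ω ∂P, ∀ k, X 0 ω k ≤ 1) (n : ℕ) (k : Fin N) {t : ℝ} (ht : 0 ≤ t) :
    HasDerivWithinAt (fun s : ℝ => ∫ ω, (X s.toNNReal ω k : ℝ) ^ n ∂P)
      (∫ ω, generator p N (fun y => (y k : ℝ) ^ n) (X t.toNNReal ω) ∂P) (Set.Ici 0) t := by
  obtain ⟨K, hK⟩ := p.exists_isBound
  refine hX.hasDerivWithinAt_integral (hK.isJumpWeight_powerWeight n)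
    (integrable_powerWeight_of_le_one (hX.measurable 0) h₁ n) (f := fun x => (x k : ℝ) ^ n)
    (K := 1) (by fun_prop) (fun x => ?_) ht
  rw [one_mul, abs_of_nonneg (by positivity)]
  exact pow_le_powerWeight n x k

theorem abs_integral_generator_pow_le (hX : IsUrnLinearSystem p N P X) (hK : p.IsBound K)
    (h₁ : ∀ᵐ ω ∂P, ∀ k, X 0 ω k ≤ 1) (n : ℕ) (t : ℝ≥0) (k : Fin N) :
    |∫ ω, generator p N (fun y => (y k : ℝ) ^ n) (X t ω) ∂P|
      ≤ 6 * K * (2 * K) ^ n * ‖fun j => ∫ ω, (X t ω j : ℝ) ^ n ∂P‖ := by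
  have hN : (0 : ℝ) < N := Nat.cast_pos.2 k.pos
  have hint := hX.integrable_pow h₁ n t
  have hmean : Integrable (fun ω => (1 / (N : ℝ)) * ∑ j, (X t ω j : ℝ) ^ n) P :=
    (integrable_finsetSum _ fun j _ => hint j).const_mul _
  have hle : ∀ j, ∫ ω, (X t ω j : ℝ) ^ n ∂P ≤ ‖fun j => ∫ ω, (X t ω j : ℝ) ^ n ∂P‖ := fun j =>
    (Real.le_norm_self _).trans (norm_le_pi_norm (fun j => ∫ ω, (X t ω j : ℝ) ^ n ∂P) j)
  set M := ‖fun j => ∫ ω, (X t ω j : ℝ) ^ n ∂P‖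
  have hK₀ := hK.nonneg
  calc |∫ ω, generator p N (fun y => (y k : ℝ) ^ n) (X t ω) ∂P|
      ≤ ∫ ω, 3 * K * (2 * K) ^ n
          * ((X t ω k : ℝ) ^ n + (1 / (N : ℝ)) * ∑ j, (X t ω j : ℝ) ^ n) ∂P :=
        norm_integral_le_of_norm_le
          (f := fun ω => generator p N (fun y => (y k : ℝ) ^ n) (X t ω))
          (((hint k).add hmean).const_mul (3 * K * (2 * K) ^ n)) (ae_of_all _ fun ω =>
            hK.abs_generator_pow_le n k (X t ω))
    _ = 3 * K * (2 * K) ^ n * (∫ ω, (X t ω k : ℝ) ^ n ∂P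
          + (1 / (N : ℝ)) * ∑ j, ∫ ω, (X t ω j : ℝ) ^ n ∂P) := by
        rw [integral_const_mul, integral_add (hint k) hmean, integral_const_mul,
          integral_finsetSum _ fun j _ => hint j]
    _ ≤ 3 * K * (2 * K) ^ n * (M + (1 / (N : ℝ)) * ∑ _ : Fin N, M) := by
        gcongr with j
        exacts [hle k, hle j]
    _ = 6 * K * (2 * K) ^ n * M := by
        rw [Finset.sum_const, Finset.card_univ, Fintype.card_fin, nsmul_eq_mul]
        field_simp
        ring

theorem integral_pow_le (hX : IsUrnLinearSystem p N P X) (hK : p.IsBound K)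
    (h₁ : ∀ᵐ ω ∂P, ∀ k, X 0 ω k ≤ 1) (n : ℕ) (t : ℝ≥0) (k : Fin N) :
    ∫ ω, (X t ω k : ℝ) ^ n ∂P ≤ Real.exp (6 * K * (2 * K) ^ n * t) := by
  have h₀ : ‖fun j => ∫ ω, (X (0 : ℝ).toNNReal ω j : ℝ) ^ n ∂P‖ ≤ 1 := by
    refine (pi_norm_le_iff_of_nonneg zero_le_one).2 fun j => ?_
    refine (norm_integral_le_of_norm_le_const (C := 1) ?_).trans_eq (by simp)
    filter_upwards [h₁] with ω hω
    rw [Real.toNNReal_zero, Real.norm_of_nonneg (by positivity)]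
    exact pow_le_one₀ (NNReal.coe_nonneg _) (hω j)
  have hgronwall := norm_le_gronwallBound
    (f := fun (s : ℝ) (j : Fin N) => ∫ ω, (X s.toNNReal ω j : ℝ) ^ n ∂P)
    (C := 6 * K * (2 * K) ^ n) (ε := 0) (T := t)
    (fun s hs => hasDerivWithinAt_pi.2 fun j => hX.hasDerivWithinAt_integral_pow h₁ n j hs) h₀
    (fun s _ => (pi_norm_le_iff_of_nonneg (by have := hK.nonneg; positivity)).2 fun j =>
      (hX.abs_integral_generator_pow_le hK h₁ n s.toNNReal j).trans_eq (add_zero _).symm)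
    ⟨NNReal.coe_nonneg t, le_rfl⟩
  rw [gronwallBound_ε0, one_mul, Real.toNNReal_coe] at hgronwall
  exact ((Real.le_norm_self _).trans
    (norm_le_pi_norm (fun j => ∫ ω, (X t ω j : ℝ) ^ n ∂P) k)).trans hgronwall

end IsUrnLinearSystem

end Moments

section InitialAssumption

variable {φ : C(I, ℝ)} {N : ℕ} {Ω : Type*} [MeasurableSpace Ω] {P : Measure Ω}
  [IsProbabilityMeasure P] {x₀ : Ω → (Fin N → ℝ≥0)}

namespace InitialAssumption

theorem ae_zero_or_one (h : InitialAssumption φ N P x₀) (hm : Measurable x₀) :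
    ∀ᵐ ω ∂P, ∀ i, x₀ ω i = 0 ∨ x₀ ω i = 1 := by
  refine ae_all_iff.2 fun i => ?_
  have hmi : Measurable fun ω => x₀ ω i := (measurable_pi_apply i).comp hm
  have h₀ : MeasurableSet {ω | x₀ ω i = 0} := hmi (measurableSet_singleton 0)
  have h₁ : MeasurableSet {ω | x₀ ω i = 1} := hmi (measurableSet_singleton 1)
  have hdisj : Disjoint {ω | x₀ ω i = 0} {ω | x₀ ω i = 1} :=
    Set.disjoint_left.2 fun ω ha hb => zero_ne_one (ha.symm.trans hb)
  have hunion : P.real ({ω | x₀ ω i = 0} ∪ {ω | x₀ ω i = 1}) = 1 := by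
    rw [measureReal_union hdisj h₁, h.prob_zero, h.prob_one, sub_add_cancel]
  rw [measureReal_def, ENNReal.toReal_eq_one_iff] at hunion
  exact (prob_compl_eq_zero_iff (h₀.union h₁)).2 hunion

theorem ae_le_one (h : InitialAssumption φ N P x₀) (hm : Measurable x₀) :
    ∀ᵐ ω ∂P, ∀ i, x₀ ω i ≤ 1 := by
  filter_upwards [h.ae_zero_or_one hm] with ω hω i
  rcases hω i with h | h <;> simp [h]

theorem integral_eq (h : InitialAssumption φ N P x₀) (hm : Measurable x₀) (i : Fin N) :
    ∫ ω, (x₀ ω i : ℝ) ∂P = φ (site i) := by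
  have hone : MeasurableSet {ω | x₀ ω i = 1} :=
    (measurable_pi_apply i).comp hm (measurableSet_singleton 1)
  rw [← h.prob_one i, ← integral_indicator_one hone]
  refine integral_congr_ae ?_
  filter_upwards [h.ae_zero_or_one hm] with ω hω
  rcases hω i with h | h <;> simp [h, Set.indicator]

theorem integral_prod (h : InitialAssumption φ N P x₀) (hm : Measurable x₀)
    (s : Finset (Fin N)) : ∫ ω, ∏ k ∈ s, (x₀ ω k : ℝ) ∂P = ∏ k ∈ s, φ (site k) := by
  have hind := (h.indep.precomp (Subtype.val_injective (p := (· ∈ s)))).comp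
    (fun _ (y : ℝ≥0) => (y : ℝ)) (fun _ => NNReal.continuous_coe.measurable)
  calc ∫ ω, ∏ k ∈ s, (x₀ ω k : ℝ) ∂P = ∫ ω, ∏ k : s, (x₀ ω k : ℝ) ∂P := by
        simp_rw [← Finset.prod_coe_sort s]
    _ = ∏ k : s, ∫ ω, (x₀ ω k : ℝ) ∂P := hind.integral_fun_prod_eq_prod_integral fun k =>
        (NNReal.continuous_coe.measurable.comp
          ((measurable_pi_apply k.1).comp hm)).aestronglyMeasurable
    _ = ∏ k : s, φ (site (k : Fin N)) := by simp_rw [h.integral_eq hm]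
    _ = _ := Finset.prod_coe_sort s fun k => φ (site k)

end InitialAssumption

end InitialAssumption

section Rates

variable (p : Coeffs)

/-- The rate at which the mass at `u` grows in proportion to itself through the single jumps. -/
noncomputable def siteRate (u : I) : ℝ := (p.b u : ℝ) * ((p.c u : ℝ) - 1)

/-- The rate at which the mass at `u` grows in proportion to itself through the pair jumps
with `v`. -/
noncomputable def selfRate (u v : I) : ℝ :=
  (p.lam (v, u) : ℝ) * ((p.a₄ (v, u) : ℝ) - 1) + (p.lam (u, v) : ℝ) * ((p.a₁ (u, v) : ℝ) - 1)

/-- The rate at which the mass at `u` grows in proportion to the mass at `v`. -/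
noncomputable def crossRate (u v : I) : ℝ :=
  (p.lam (u, v) : ℝ) * (p.a₂ (u, v) : ℝ) + (p.lam (v, u) : ℝ) * (p.a₃ (v, u) : ℝ)

/-- The rate at which the mass `f u` at `u` grows through the pair jumps with `v`. -/
noncomputable def pairGrowth (f : I → ℝ) (u v : I) : ℝ :=
  selfRate p u v * f u + crossRate p u v * f v

theorem continuous_selfRate : Continuous fun z : I × I => selfRate p z.1 z.2 := by
  unfold selfRate; fun_prop

theorem continuous_crossRate : Continuous fun z : I × I => crossRate p z.1 z.2 := by
  unfold crossRate; fun_prop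

theorem densityOp_apply (f : C(I, ℝ)) (u : I) :
    densityOp p f u = siteRate p u * f u + ∫ v : I, pairGrowth p f u v := by
  have hint : ∀ {g : I → ℝ}, Continuous g → Integrable g (volume : Measure I) := fun hg =>
    hg.integrable_of_hasCompactSupport (HasCompactSupport.of_compactSpace _)
  have hsplit : ∀ v, pairGrowth p f u v
      = f u * ((p.lam (v, u) : ℝ) * ((p.a₄ (v, u) : ℝ) - 1))
        + f u * ((p.lam (u, v) : ℝ) * ((p.a₁ (u, v) : ℝ) - 1))
        + (p.lam (u, v) : ℝ) * (p.a₂ (u, v) : ℝ) * f v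
        + (p.lam (v, u) : ℝ) * (p.a₃ (v, u) : ℝ) * f v := fun v => by
    unfold pairGrowth selfRate crossRate
    ring
  simp_rw [hsplit]
  rw [integral_add (hint (by fun_prop)) (hint (by fun_prop)),
    integral_add (hint (by fun_prop)) (hint (by fun_prop)),
    integral_add (hint (by fun_prop)) (hint (by fun_prop)),
    integral_const_mul, integral_const_mul, ← add_assoc, ← add_assoc, ← add_assoc]
  rfl

variable {p} {K : ℝ}

namespace Coeffs.IsBound

variable (hK : p.IsBound K)
include hK

theorem abs_mul_sub_one_le {l a : ℝ≥0} (hl : (l : ℝ) ≤ K) (ha : (a : ℝ) ≤ K) :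
    |(l : ℝ) * ((a : ℝ) - 1)| ≤ K ^ 2 := by
  rw [abs_mul, NNReal.abs_eq, sq]
  exact mul_le_mul hl (abs_sub_le_of_nonneg_of_le a.2 ha zero_le_one hK.one_le) (abs_nonneg _)
    hK.nonneg

theorem abs_mul_le {l a : ℝ≥0} (hl : (l : ℝ) ≤ K) (ha : (a : ℝ) ≤ K) :
    |(l : ℝ) * (a : ℝ)| ≤ K ^ 2 := by
  rw [abs_mul, NNReal.abs_eq, NNReal.abs_eq, sq]
  exact mul_le_mul hl ha a.2 hK.nonneg

theorem abs_siteRate_le (u : I) : |siteRate p u| ≤ K ^ 2 :=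
  hK.abs_mul_sub_one_le (hK.b u) (hK.c u)

theorem abs_selfRate_le (u v : I) : |selfRate p u v| ≤ 2 * K ^ 2 :=
  (abs_add_le _ _).trans ((add_le_add (hK.abs_mul_sub_one_le (hK.lam _) (hK.a₄ _))
    (hK.abs_mul_sub_one_le (hK.lam _) (hK.a₁ _))).trans_eq (two_mul _).symm)

theorem abs_crossRate_le (u v : I) : |crossRate p u v| ≤ 2 * K ^ 2 :=
  (abs_add_le _ _).trans ((add_le_add (hK.abs_mul_le (hK.lam _) (hK.a₂ _))
    (hK.abs_mul_le (hK.lam _) (hK.a₃ _))).trans_eq (two_mul _).symm)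

theorem abs_pairGrowth_le {f : I → ℝ} {R : ℝ} (hf : ∀ u, |f u| ≤ R) (u v : I) :
    |pairGrowth p f u v| ≤ 4 * K ^ 2 * R := calc
  _ ≤ |selfRate p u v| * |f u| + |crossRate p u v| * |f v| := by
    simpa only [abs_mul, pairGrowth] using abs_add_le (selfRate p u v * f u) (crossRate p u v * f v)
  _ ≤ 2 * K ^ 2 * R + 2 * K ^ 2 * R := by
    gcongr
    exacts [hK.abs_selfRate_le u v, hf u, hK.abs_crossRate_le u v, hf v]
  _ = 4 * K ^ 2 * R := by ring

end Coeffs.IsBound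

end Rates

section CorrelationOperator

variable (p : Coeffs) {N : ℕ}

/-- The linear operator that drives the correlations `s ↦ E ∏ₛ X`, up to an error of order `1/N`.
It sends a function of finite sets of urns to its value at `s`; the sets that occur all have the
cardinality of `s`. -/
noncomputable def corrOp (s : Finset (Fin N)) : (Finset (Fin N) → ℝ) →L[ℝ] ℝ :=
  ∑ k ∈ s, (siteRate p (site k) • .proj s + (1 / (N : ℝ)) • ∑ j ∈ sᶜ,
    (selfRate p (site k) (site j) • .proj s
      + crossRate p (site k) (site j) • .proj (insert j (s.erase k))))

theorem corrOp_apply (s : Finset (Fin N)) (w : Finset (Fin N) → ℝ) :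
    corrOp p s w = ∑ k ∈ s, (siteRate p (site k) * w s + (1 / (N : ℝ)) * ∑ j ∈ sᶜ,
      (selfRate p (site k) (site j) * w s
        + crossRate p (site k) (site j) * w (insert j (s.erase k)))) := by
  simp [corrOp]

theorem card_insert_erase {α : Type*} [DecidableEq α] {s : Finset α} {k j : α} (hk : k ∈ s)
    (hj : j ∉ s) : (insert j (s.erase k)).card = s.card := by
  rw [Finset.card_insert_of_notMem (fun h => hj (Finset.mem_of_mem_erase h)),
    Finset.card_erase_add_one hk]

variable {p} {K : ℝ}

theorem Coeffs.IsBound.abs_sum_selfRate_add_crossRate_le (hK : p.IsBound K)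
    {w : Finset (Fin N) → ℝ} {B : ℝ} {s : Finset (Fin N)} (hw : ∀ s', s'.card = s.card → |w s'| ≤ B)
    {k : Fin N} (hk : k ∈ s) :
    |∑ j ∈ sᶜ, (selfRate p (site k) (site j) * w s
        + crossRate p (site k) (site j) * w (insert j (s.erase k)))| ≤ N * (4 * K ^ 2 * B) := by
  have hB : 0 ≤ B := (abs_nonneg _).trans (hw s rfl)
  calc _ ≤ ∑ j ∈ sᶜ, (2 * K ^ 2 * B + 2 * K ^ 2 * B) := by
        refine (Finset.abs_sum_le_sum_abs _ _).trans (Finset.sum_le_sum fun j hj => ?_)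
        refine (abs_add_le _ _).trans ?_
        rw [abs_mul, abs_mul]
        gcongr
        exacts [hK.abs_selfRate_le _ _, hw s rfl, hK.abs_crossRate_le _ _,
          hw _ (card_insert_erase hk (Finset.mem_compl.1 hj))]
    _ ≤ ∑ _ : Fin N, (2 * K ^ 2 * B + 2 * K ^ 2 * B) :=
        Finset.sum_le_sum_of_subset_of_nonneg (Finset.subset_univ _) fun _ _ _ => by positivity
    _ = _ := by
        rw [Finset.sum_const, Finset.card_univ, Fintype.card_fin, nsmul_eq_mul]
        ring

theorem Coeffs.IsBound.abs_corrOp_le (hK : p.IsBound K) {w : Finset (Fin N) → ℝ} {B : ℝ}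
    {s : Finset (Fin N)} (hw : ∀ s', s'.card = s.card → |w s'| ≤ B) :
    |corrOp p s w| ≤ 5 * s.card * K ^ 2 * B := by
  have hsite : ∀ k : Fin N, |siteRate p (site k) * w s| ≤ K ^ 2 * B := fun k => by
    rw [abs_mul]
    exact mul_le_mul (hK.abs_siteRate_le _) (hw s rfl) (abs_nonneg _) (sq_nonneg K)
  rw [corrOp_apply]
  calc _ ≤ ∑ _ ∈ s, 5 * K ^ 2 * B := by
        refine (Finset.abs_sum_le_sum_abs _ _).trans (Finset.sum_le_sum fun k hk => ?_)
        have hN : (0 : ℝ) < N := Nat.cast_pos.2 k.pos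
        refine (abs_add_le _ _).trans ?_
        rw [abs_mul (1 / (N : ℝ)), abs_of_pos (by positivity : 0 < 1 / (N : ℝ))]
        refine (add_le_add (hsite k) (mul_le_mul_of_nonneg_left
          (hK.abs_sum_selfRate_add_crossRate_le hw hk) (by positivity))).trans_eq ?_
        field_simp
        ring
    _ = _ := by
        rw [Finset.sum_const, nsmul_eq_mul]
        ring

end CorrelationOperator

section Monomials

variable (p : Coeffs) {N : ℕ}

/-- The contribution to `L (∏ₛ x)` of the pair jumps with both urns in `s`. -/
noncomputable def innerPairTerm (s : Finset (Fin N)) (x : Fin N → ℝ≥0) : ℝ :=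
  (1 / (N : ℝ)) * ∑ i ∈ s, ∑ j ∈ s.erase i,
    (p.lam (site i, site j) : ℝ) * (∏ k ∈ s, (pairJump p i j x k : ℝ) - ∏ k ∈ s, (x k : ℝ))

theorem prod_eq_mul_prod_erase {s : Finset (Fin N)} {i : Fin N} (hi : i ∈ s) {x y : Fin N → ℝ≥0}
    (h : ∀ k ∈ s.erase i, y k = x k) :
    ∏ k ∈ s, (y k : ℝ) = y i * ∏ k ∈ s.erase i, (x k : ℝ) := by
  rw [← Finset.mul_prod_erase s _ hi, Finset.prod_congr rfl fun k hk => by rw [h k hk]]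

theorem singleJump_prod_sub {s : Finset (Fin N)} {i : Fin N} (hi : i ∈ s) (x : Fin N → ℝ≥0) :
    (p.b (site i) : ℝ) * (∏ k ∈ s, (singleJump p i x k : ℝ) - ∏ k ∈ s, (x k : ℝ))
      = siteRate p (site i) * ∏ k ∈ s, (x k : ℝ) := by
  rw [prod_eq_mul_prod_erase hi fun k hk => singleJump_of_ne x (Finset.ne_of_mem_erase hk),
    prod_eq_mul_prod_erase hi fun k _ => rfl, singleJump_self]
  unfold siteRate
  push_cast
  ring

theorem pairJump_prod_sub {s : Finset (Fin N)} {i j : Fin N} (hi : i ∈ s) (hj : j ∉ s)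
    (x : Fin N → ℝ≥0) :
    (p.lam (site i, site j) : ℝ) * (∏ k ∈ s, (pairJump p i j x k : ℝ) - ∏ k ∈ s, (x k : ℝ))
        + (p.lam (site j, site i) : ℝ) * (∏ k ∈ s, (pairJump p j i x k : ℝ) - ∏ k ∈ s, (x k : ℝ))
      = selfRate p (site i) (site j) * ∏ k ∈ s, (x k : ℝ)
        + crossRate p (site i) (site j) * ∏ k ∈ insert j (s.erase i), (x k : ℝ) := by
  have hne : ∀ k ∈ s.erase i, k ≠ i ∧ k ≠ j := fun k hk =>
    ⟨Finset.ne_of_mem_erase hk, ne_of_mem_of_not_mem (Finset.mem_of_mem_erase hk) hj⟩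
  rw [Finset.prod_insert fun h => hj (Finset.mem_of_mem_erase h),
    prod_eq_mul_prod_erase hi fun k hk => pairJump_of_ne x (hne k hk).1 (hne k hk).2,
    prod_eq_mul_prod_erase hi fun k hk => pairJump_of_ne x (hne k hk).2 (hne k hk).1,
    prod_eq_mul_prod_erase hi fun k _ => rfl, pairJump_left,
    pairJump_right x (ne_of_mem_of_not_mem hi hj)]
  unfold selfRate crossRate
  push_cast
  ring

theorem generator_monomial (s : Finset (Fin N)) (x : Fin N → ℝ≥0) :
    generator p N (fun y => ∏ k ∈ s, (y k : ℝ)) x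
      = corrOp p s (fun s' => ∏ k ∈ s', (x k : ℝ)) + innerPairTerm p s x := by
  rw [generator_of_dependsOn (s := s) fun x y h =>
      Finset.prod_congr rfl fun k hk => by rw [h k (Finset.mem_coe.2 hk)],
    Finset.sum_congr rfl fun i hi => singleJump_prod_sub p hi x,
    Finset.sum_congr rfl fun i hi => Finset.sum_congr rfl fun _ hj =>
      pairJump_prod_sub p hi (Finset.mem_compl.1 hj) x,
    corrOp_apply, Finset.sum_add_distrib, ← Finset.mul_sum, mul_add, add_assoc]
  rfl

theorem prod_le_sum_pow_card {ι : Type*} {s : Finset ι} (hs : s.Nonempty) (y : ι → ℝ≥0) :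
    ∏ k ∈ s, (y k : ℝ) ≤ ∑ k ∈ s, (y k : ℝ) ^ s.card := by
  obtain ⟨m, hm, hmax⟩ := s.exists_max_image y hs
  calc ∏ k ∈ s, (y k : ℝ) ≤ (y m : ℝ) ^ s.card :=
        (Finset.prod_le_prod (fun _ _ => NNReal.coe_nonneg _) fun k hk =>
          NNReal.coe_le_coe.2 (hmax k hk)).trans_eq (Finset.prod_const _)
    _ ≤ _ := Finset.single_le_sum (f := fun k => (y k : ℝ) ^ s.card)
        (fun _ _ => by positivity) hm

variable {p} {K : ℝ}

namespace Coeffs.IsBound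

theorem abs_rate_mul_pairJump_prod_sub_le (hK : p.IsBound K) {s : Finset (Fin N)} {i j : Fin N}
    (hi : i ∈ s) (hj : j ∈ s) (x : Fin N → ℝ≥0) :
    |(p.lam (site i, site j) : ℝ) * (∏ k ∈ s, (pairJump p i j x k : ℝ) - ∏ k ∈ s, (x k : ℝ))|
      ≤ K * (2 * K) ^ s.card * (s.card * ∑ k ∈ s, (x k : ℝ) ^ s.card) := by
  have hs : s.Nonempty := ⟨i, hi⟩
  have hcard : (1 : ℝ) ≤ s.card := Nat.one_le_cast.2 hs.card_pos
  refine hK.abs_rate_mul_sub_le s.card (hK.lam _) (by positivity) (by positivity) ?_ ?_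
  · exact (prod_le_sum_pow_card hs x).trans (le_mul_of_one_le_left (by positivity) hcard)
  · calc _ ≤ ∑ k ∈ s, (pairJump p i j x k : ℝ) ^ s.card := prod_le_sum_pow_card hs _
      _ ≤ ∑ _ ∈ s, (2 * K) ^ s.card * ∑ l ∈ s, (x l : ℝ) ^ s.card :=
          Finset.sum_le_sum fun k hk => hK.pairJump_pow_le_sum x s.card hi hj hk
      _ = _ := by
          rw [Finset.sum_const, nsmul_eq_mul]
          ring

theorem abs_innerPairTerm_le (hK : p.IsBound K) (s : Finset (Fin N)) (x : Fin N → ℝ≥0) :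
    |innerPairTerm p s x|
      ≤ (1 / (N : ℝ)) * (s.card ^ 3 * K * (2 * K) ^ s.card * ∑ k ∈ s, (x k : ℝ) ^ s.card) := by
  set B := K * (2 * K) ^ s.card * (s.card * ∑ k ∈ s, (x k : ℝ) ^ s.card)
  have hB : 0 ≤ B := by
    have := hK.nonneg
    positivity
  unfold innerPairTerm
  rw [abs_mul, abs_of_nonneg (by positivity : (0 : ℝ) ≤ 1 / N)]
  refine mul_le_mul_of_nonneg_left ?_ (by positivity)
  calc _ ≤ ∑ i ∈ s, ∑ _ ∈ s.erase i, B :=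
        (Finset.abs_sum_le_sum_abs _ _).trans <| Finset.sum_le_sum fun i hi =>
          (Finset.abs_sum_le_sum_abs _ _).trans <| Finset.sum_le_sum fun _ hj =>
            hK.abs_rate_mul_pairJump_prod_sub_le hi (Finset.mem_of_mem_erase hj) x
    _ ≤ ∑ _ ∈ s, ∑ _ ∈ s, B := Finset.sum_le_sum fun i _ =>
        Finset.sum_le_sum_of_subset_of_nonneg (Finset.erase_subset i s) fun _ _ _ => hB
    _ = _ := by
        simp only [Finset.sum_const, nsmul_eq_mul, B]
        ring

end Coeffs.IsBound

end Monomials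

section Correlations

variable {p : Coeffs} {K : ℝ} {N : ℕ} {Ω : Type*} [MeasurableSpace Ω] {P : Measure Ω}
  {X : ℝ≥0 → Ω → (Fin N → ℝ≥0)}

/-- The correlations `s ↦ E ∏ₛ Y` of a random configuration `Y`. -/
noncomputable def correlation (P : Measure Ω) (Y : Ω → (Fin N → ℝ≥0)) (s : Finset (Fin N)) : ℝ :=
  ∫ ω, ∏ k ∈ s, (Y ω k : ℝ) ∂P

theorem measurable_monomial (s : Finset (Fin N)) :
    Measurable fun x : Fin N → ℝ≥0 => ∏ k ∈ s, (x k : ℝ) := by fun_prop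

theorem abs_monomial_le_powerWeight (s : Finset (Fin N)) (x : Fin N → ℝ≥0) :
    |∏ k ∈ s, (x k : ℝ)| ≤ 1 * powerWeight s.card x := by
  rw [one_mul, abs_of_nonneg (by positivity), powerWeight]
  rcases s.eq_empty_or_nonempty with rfl | hs
  · simp
  · have hsub : ∑ k ∈ s, (x k : ℝ) ^ s.card ≤ ∑ k, (x k : ℝ) ^ s.card :=
      Finset.sum_le_sum_of_subset_of_nonneg (Finset.subset_univ s) fun _ _ _ => by positivity
    linarith [prod_le_sum_pow_card hs x]

theorem integral_corrOp {w : Ω → Finset (Fin N) → ℝ} (hw : ∀ s, Integrable (fun ω => w ω s) P)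
    (s : Finset (Fin N)) : ∫ ω, corrOp p s (w ω) ∂P = corrOp p s fun s' => ∫ ω, w ω s' ∂P := by
  rw [(corrOp p s).integral_comp_comm (Integrable.of_eval hw)]
  exact congrArg (corrOp p s) (funext fun s' => eval_integral hw s')

namespace IsUrnLinearSystem

variable [IsProbabilityMeasure P] (hX : IsUrnLinearSystem p N P X) (h₁ : ∀ᵐ ω ∂P, ∀ k, X 0 ω k ≤ 1)
include hX h₁

theorem integrable_monomial (t : ℝ≥0) (s : Finset (Fin N)) :
    Integrable (fun ω => ∏ k ∈ s, (X t ω k : ℝ)) P :=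
  integrable_comp_of_abs_le (measurable_monomial s) (abs_monomial_le_powerWeight s)
    (hX.measurable t) (hX.integrable_powerWeight h₁ s.card t)

theorem integrable_corrOp (t : ℝ≥0) (s : Finset (Fin N)) :
    Integrable (fun ω => corrOp p s fun s' => ∏ k ∈ s', (X t ω k : ℝ)) P :=
  (corrOp p s).integrable_comp (Integrable.of_eval (hX.integrable_monomial h₁ t))

theorem integrable_innerPairTerm (t : ℝ≥0) (s : Finset (Fin N)) :
    Integrable (fun ω => innerPairTerm p s (X t ω)) P := by
  obtain ⟨K, hK⟩ := p.exists_isBound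
  have hgen := integrable_comp_of_abs_le (measurable_generator (p := p) (measurable_monomial s))
    ((hK.isJumpWeight_powerWeight s.card).abs_generator_le (abs_monomial_le_powerWeight s))
    (hX.measurable t) (hX.integrable_powerWeight h₁ s.card t)
  refine (hgen.sub (hX.integrable_corrOp h₁ t s)).congr (ae_of_all _ fun ω => ?_)
  simp only [Pi.sub_apply, generator_monomial, add_sub_cancel_left]

theorem hasDerivWithinAt_correlation (s : Finset (Fin N)) {t : ℝ} (ht : 0 ≤ t) :
    HasDerivWithinAt (fun t : ℝ => correlation P (X t.toNNReal) s)
      (corrOp p s (correlation P (X t.toNNReal)) + ∫ ω, innerPairTerm p s (X t.toNNReal ω) ∂P)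
      (Set.Ici 0) t := by
  obtain ⟨K, hK⟩ := p.exists_isBound
  have h := hX.hasDerivWithinAt_integral (hK.isJumpWeight_powerWeight s.card)
    (integrable_powerWeight_of_le_one (hX.measurable 0) h₁ s.card) (measurable_monomial s)
    (abs_monomial_le_powerWeight s) ht
  simp_rw [generator_monomial] at h
  rwa [integral_add (hX.integrable_corrOp h₁ _ s) (hX.integrable_innerPairTerm h₁ _ s),
    integral_corrOp (hX.integrable_monomial h₁ _)] at h

theorem abs_integral_innerPairTerm_le (hK : p.IsBound K) (t : ℝ≥0) (s : Finset (Fin N)) :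
    |∫ ω, innerPairTerm p s (X t ω) ∂P| ≤ (1 / (N : ℝ)) *
      (s.card ^ 4 * K * (2 * K) ^ s.card * Real.exp (6 * K * (2 * K) ^ s.card * t)) := by
  have hK₀ := hK.nonneg
  have hint := integrable_finsetSum s fun k _ => hX.integrable_pow h₁ s.card t k
  calc _ ≤ ∫ ω, (1 / (N : ℝ)) * (s.card ^ 3 * K * (2 * K) ^ s.card
          * ∑ k ∈ s, (X t ω k : ℝ) ^ s.card) ∂P :=
        norm_integral_le_of_norm_le (f := fun ω => innerPairTerm p s (X t ω))
          ((hint.const_mul (s.card ^ 3 * K * (2 * K) ^ s.card)).const_mul (1 / (N : ℝ)))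
          (ae_of_all _ fun ω => hK.abs_innerPairTerm_le s (X t ω))
    _ = (1 / (N : ℝ)) * (s.card ^ 3 * K * (2 * K) ^ s.card
          * ∑ k ∈ s, ∫ ω, (X t ω k : ℝ) ^ s.card ∂P) := by
        rw [integral_const_mul, integral_const_mul,
          integral_finsetSum _ fun k _ => hX.integrable_pow h₁ s.card t k]
    _ ≤ (1 / (N : ℝ)) * (s.card ^ 3 * K * (2 * K) ^ s.card
          * ∑ _ ∈ s, Real.exp (6 * K * (2 * K) ^ s.card * t)) := by
        gcongr with k
        exact hX.integral_pow_le hK h₁ s.card t k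
    _ = _ := by
        rw [Finset.sum_const, nsmul_eq_mul]
        ring

end IsUrnLinearSystem

end Correlations

section RiemannSum

theorem integral_eq_sum_intervalIntegral {f : I → ℝ} (hf : Continuous f) {N : ℕ} (hN : 0 < N) :
    ∫ v : I, f v = ∑ i : Fin N, ∫ x in ((i : ℕ) / N : ℝ)..((i + 1 : ℕ) / N : ℝ),
      f (Set.projIcc 0 1 zero_le_one x) := by
  have hN' : (N : ℝ) ≠ 0 := Nat.cast_ne_zero.2 hN.ne'
  have hg : Continuous fun x : ℝ => f (Set.projIcc 0 1 zero_le_one x) :=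
    hf.comp continuous_projIcc
  have hsum := intervalIntegral.sum_integral_adjacent_intervals (μ := volume) (n := N)
    (a := fun i : ℕ => (i / N : ℝ)) fun k _ => hg.intervalIntegrable _ _
  rw [Finset.sum_range] at hsum
  rw [hsum, Nat.cast_zero, zero_div, div_self hN', intervalIntegral.integral_of_le zero_le_one,
    ← integral_Icc_eq_integral_Ioc, ← integral_subtype_comap measurableSet_Icc,
    unitInterval.volume_def]
  exact integral_congr_ae (ae_of_all _ fun v => by simp only [Set.projIcc_val])

theorem dist_projIcc_site_le {N : ℕ} (i : Fin N) {x : ℝ}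
    (hx : x ∈ Set.Icc ((i : ℕ) / N : ℝ) ((i + 1 : ℕ) / N : ℝ)) :
    dist (Set.projIcc 0 1 zero_le_one x) (site i) ≤ 1 / N := by
  have hsite : (site i : ℝ) = (i + 1 : ℕ) / N := by simp [site]
  have hx01 : x ∈ Set.Icc (0 : ℝ) 1 :=
    ⟨le_trans (by positivity) hx.1, hx.2.trans (hsite ▸ (site i).2.2)⟩
  have hcell : ((i + 1 : ℕ) / N : ℝ) = (i : ℕ) / N + 1 / N := by push_cast; ring
  rw [Set.projIcc_of_mem zero_le_one hx01, Subtype.dist_eq, hsite, Real.dist_eq, abs_sub_le_iff]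
  constructor <;> linarith [hx.1, hx.2]

theorem abs_riemannSum_sub_integral_le {f : I → ℝ} (hf : Continuous f) {N : ℕ} (hN : 0 < N)
    {ε : ℝ} (h : ∀ u v : I, dist u v ≤ 1 / N → |f u - f v| ≤ ε) :
    |(1 / (N : ℝ)) * ∑ i : Fin N, f (site i) - ∫ v : I, f v| ≤ ε := by
  have hN' : (0 : ℝ) < N := Nat.cast_pos.2 hN
  have hg : Continuous fun x : ℝ => f (Set.projIcc 0 1 zero_le_one x) :=
    hf.comp continuous_projIcc
  have hlen : ∀ i : ℕ, ((i + 1 : ℕ) / N : ℝ) - i / N = 1 / N := fun i => by push_cast; ring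
  have hcell : ∀ i : Fin N, |1 / (N : ℝ) * f (site i) - ∫ x in ((i : ℕ) / N : ℝ)..
      ((i + 1 : ℕ) / N : ℝ), f (Set.projIcc 0 1 zero_le_one x)| ≤ ε * (1 / N) := by
    intro i
    have hle : ((i : ℕ) / N : ℝ) ≤ ((i + 1 : ℕ) / N : ℝ) := by gcongr; simp
    have hconst : 1 / (N : ℝ) * f (site i)
        = ∫ _ in ((i : ℕ) / N : ℝ)..((i + 1 : ℕ) / N : ℝ), f (site i) := by
      rw [intervalIntegral.integral_const, smul_eq_mul, hlen]
    rw [hconst, ← intervalIntegral.integral_sub intervalIntegrable_const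
      (hg.intervalIntegrable _ _)]
    refine (intervalIntegral.norm_integral_le_of_norm_le_const (E := ℝ) (C := ε)
      fun x hx => ?_).trans_eq (by rw [hlen i, abs_of_pos (one_div_pos.2 hN')])
    rw [Set.uIoc_of_le hle] at hx
    exact h _ _ ((dist_comm _ _).trans_le (dist_projIcc_site_le i ⟨hx.1.le, hx.2⟩))
  rw [integral_eq_sum_intervalIntegral hf hN, Finset.mul_sum, ← Finset.sum_sub_distrib]
  refine (Finset.abs_sum_le_sum_abs _ _).trans ((Finset.sum_le_sum fun i _ => hcell i).trans_eq ?_)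
  rw [Finset.sum_const, Finset.card_univ, Fintype.card_fin, nsmul_eq_mul]
  field_simp

variable {Y : Type*} [PseudoMetricSpace Y] [CompactSpace Y] {ε : ℝ}

theorem eventually_abs_riemannSum_sub_integral_le {F : Y → I → ℝ}
    (hF : Continuous (Function.uncurry F)) (hε : 0 < ε) :
    ∀ᶠ N : ℕ in atTop, ∀ y : Y,
      |(1 / (N : ℝ)) * ∑ i : Fin N, F y (site i) - ∫ v : I, F y v| ≤ ε := by
  obtain ⟨δ, hδ, h⟩ := Metric.uniformContinuous_iff.1
    (CompactSpace.uniformContinuous_of_continuous hF) ε hε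
  have hlim := (tendsto_one_div_atTop_nhds_zero_nat (𝕜 := ℝ)).eventually (gt_mem_nhds hδ)
  filter_upwards [hlim, eventually_gt_atTop 0] with N hN hN0 y
  refine abs_riemannSum_sub_integral_le (hF.comp (by fun_prop : Continuous fun v => (y, v))) hN0
    fun u v huv => (h (a := (y, u)) (b := (y, v)) ?_).le
  simpa [Prod.dist_eq] using huv.trans_lt hN

theorem eventually_abs_riemannSum_sub_integral_integral_le {F : Y → I → I → ℝ}
    (hF : Continuous fun z : (Y × I) × I => F z.1.1 z.1.2 z.2) (hε : 0 < ε) :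
    ∀ᶠ N : ℕ in atTop, ∀ y : Y,
      |(1 / (N : ℝ)) * ∑ i : Fin N, (1 / (N : ℝ)) * ∑ j : Fin N, F y (site i) (site j)
        - ∫ u : I, ∫ v : I, F y u v| ≤ ε := by
  have hint : Continuous (Function.uncurry fun y u => ∫ v : I, F y u v) := by
    simpa only [Measure.restrict_univ] using! continuous_parametric_integral_of_continuous
      (μ := (volume : Measure I)) (f := fun (z : Y × I) v => F z.1 z.2 v) hF isCompact_univ
  filter_upwards [eventually_abs_riemannSum_sub_integral_le
    (F := fun (z : Y × I) v => F z.1 z.2 v) hF (half_pos hε),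
    eventually_abs_riemannSum_sub_integral_le hint (half_pos hε), eventually_gt_atTop 0]
    with N hinner houter hN y
  have havg : |(1 / (N : ℝ)) * ∑ i : Fin N, (1 / (N : ℝ)) * ∑ j : Fin N, F y (site i) (site j)
      - (1 / (N : ℝ)) * ∑ i : Fin N, ∫ v : I, F y (site i) v| ≤ ε / 2 := by
    rw [← mul_sub, ← Finset.sum_sub_distrib, abs_mul, abs_of_nonneg (by positivity)]
    calc _ ≤ 1 / (N : ℝ) * ∑ _i : Fin N, ε / 2 := by
          gcongr
          exact (Finset.abs_sum_le_sum_abs _ _).trans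
            (Finset.sum_le_sum fun i _ => hinner (y, site i))
      _ = ε / 2 := by
          rw [Finset.sum_const, Finset.card_univ, Fintype.card_fin, nsmul_eq_mul]
          field_simp
  exact (abs_sub_le _ _ _).trans ((add_le_add havg (houter y)).trans_eq (add_halves ε))

end RiemannSum

section Density

variable {p : Coeffs} {φ : C(I, ℝ)} {ρ : ℝ → C(I, ℝ)}

namespace IsHydrodynamicDensity

variable (hρ : IsHydrodynamicDensity p φ ρ)
include hρ

theorem continuous : Continuous fun t : ℝ≥0 => ρ t :=
  ContinuousOn.comp_continuous (s := Set.Ici 0)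
    (fun t ht => (hρ.deriv t ht).continuousWithinAt) NNReal.continuous_coe fun t => t.2

theorem exists_bound (T : ℝ≥0) : ∃ R : ℝ, 1 ≤ R ∧ ∀ t : ℝ≥0, t ≤ T → ∀ u, |ρ t u| ≤ R := by
  obtain ⟨C, hC⟩ := (isCompact_Icc (a := (0 : ℝ≥0)) (b := T)).exists_bound_of_continuousOn
    hρ.continuous.continuousOn
  exact ⟨max 1 C, le_max_left _ _, fun t ht u =>
    ((ρ t).norm_coe_le_norm u).trans ((hC t ⟨zero_le, ht⟩).trans (le_max_right _ _))⟩

theorem hasDerivWithinAt_prod {N : ℕ} (s : Finset (Fin N)) {t : ℝ} (ht : 0 ≤ t) :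
    HasDerivWithinAt (fun t => ∏ k ∈ s, ρ t (site k))
      (∑ k ∈ s, (∏ j ∈ s.erase k, ρ t (site j)) * densityOp p (ρ t) (site k)) (Set.Ici 0) t := by
  have heval : ∀ u : I, HasDerivWithinAt (fun t => ρ t u) (densityOp p (ρ t) u) (Set.Ici 0) t :=
    fun u => (ContinuousMap.evalCLM ℝ u : C(I, ℝ) →L[ℝ] ℝ).hasFDerivAt.comp_hasDerivWithinAt t
      (hρ.deriv t ht)
  simpa only [smul_eq_mul] using
    HasDerivWithinAt.fun_finsetProd (u := s) fun k _ => heval (site k)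

end IsHydrodynamicDensity

theorem prod_erase_mul_densityOp_sub {N : ℕ} (f : C(I, ℝ)) {s : Finset (Fin N)} {k : Fin N}
    (hk : k ∈ s) :
    (∏ j ∈ s.erase k, f (site j)) * densityOp p f (site k)
      - (siteRate p (site k) * ∏ l ∈ s, f (site l) + (1 / (N : ℝ)) * ∑ j ∈ sᶜ,
        (selfRate p (site k) (site j) * ∏ l ∈ s, f (site l)
          + crossRate p (site k) (site j) * ∏ l ∈ insert j (s.erase k), f (site l)))
      = (∏ j ∈ s.erase k, f (site j)) *
        (((∫ v : I, pairGrowth p f (site k) v)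
          - (1 / (N : ℝ)) * ∑ j : Fin N, pairGrowth p f (site k) (site j))
          + (1 / (N : ℝ)) * ∑ j ∈ s, pairGrowth p f (site k) (site j)) := by
  rw [← Finset.mul_prod_erase s _ hk]
  set Q := ∏ j ∈ s.erase k, f (site j)
  have hcompl : ∑ j ∈ sᶜ, (selfRate p (site k) (site j) * (f (site k) * Q)
        + crossRate p (site k) (site j) * ∏ l ∈ insert j (s.erase k), f (site l))
      = Q * ∑ j ∈ sᶜ, pairGrowth p f (site k) (site j) := by
    rw [Finset.mul_sum]
    refine Finset.sum_congr rfl fun j hj => ?_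
    rw [Finset.prod_insert fun h => Finset.mem_compl.1 hj (Finset.mem_of_mem_erase h), pairGrowth]
    ring
  rw [hcompl, densityOp_apply, ← Finset.sum_add_sum_compl s]
  ring

theorem Coeffs.IsBound.abs_prod_density_sub_corrOp_le {K : ℝ} (hK : p.IsBound K) {f : C(I, ℝ)}
    {R ε : ℝ} (hR : 1 ≤ R) (hf : ∀ u, |f u| ≤ R) {N : ℕ} (hε : ∀ u, |(1 / (N : ℝ)) *
      ∑ j : Fin N, pairGrowth p f u (site j) - ∫ v : I, pairGrowth p f u v| ≤ ε)
    (s : Finset (Fin N)) :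
    |∑ k ∈ s, (∏ j ∈ s.erase k, f (site j)) * densityOp p f (site k)
      - corrOp p s (fun s => ∏ k ∈ s, f (site k))|
        ≤ s.card * (R ^ s.card * (ε + (1 / (N : ℝ)) * (s.card * (4 * K ^ 2 * R)))) := by
  rw [corrOp_apply, ← Finset.sum_sub_distrib, ← nsmul_eq_mul]
  refine (Finset.abs_sum_le_sum_abs _ _).trans (Finset.sum_le_card_nsmul _ _ _ fun k hk => ?_)
  rw [prod_erase_mul_densityOp_sub f hk, abs_mul]
  have hprod : |∏ j ∈ s.erase k, f (site j)| ≤ R ^ s.card := by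
    rw [Finset.abs_prod]
    exact ((Finset.prod_le_prod (fun _ _ => abs_nonneg _) fun j _ => hf (site j)).trans_eq
      (Finset.prod_const R)).trans (pow_le_pow_right₀ hR Finset.card_erase_le)
  have hinner : |∑ j ∈ s, pairGrowth p f (site k) (site j)| ≤ s.card * (4 * K ^ 2 * R) := by
    rw [← nsmul_eq_mul]
    exact (Finset.abs_sum_le_sum_abs _ _).trans
      (Finset.sum_le_card_nsmul _ _ _ fun j _ => hK.abs_pairGrowth_le hf _ _)
  refine mul_le_mul hprod ((abs_add_le _ _).trans (add_le_add ?_ ?_)) (abs_nonneg _)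
    (by positivity)
  · rw [abs_sub_comm]
    exact hε (site k)
  · rw [abs_mul, abs_of_nonneg (by positivity : (0 : ℝ) ≤ 1 / N)]
    gcongr

end Density

section Chaos

variable {p : Coeffs} {φ : C(I, ℝ)} {ρ : ℝ → C(I, ℝ)} {K : ℝ}

/-- The deviation of a correlation from the value it would have if the coordinates at the urns
of `s` were independent with means given by `f`. -/
noncomputable def correlationError {N : ℕ} {Ω : Type*} [MeasurableSpace Ω] (P : Measure Ω)
    (Y : Ω → (Fin N → ℝ≥0)) (f : I → ℝ) (s : Finset (Fin N)) : ℝ :=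
  correlation P Y s - ∏ k ∈ s, f (site k)

/-- The inhomogeneous term in the linear differential equation with operator `corrOp` satisfied by
the correlation errors: jumps inside `s`, and the Riemann sum error of the hydrodynamic
equation. -/
noncomputable def correlationDefect (p : Coeffs) {N : ℕ} {Ω : Type*} [MeasurableSpace Ω]
    (P : Measure Ω) (Y : Ω → (Fin N → ℝ≥0)) (f : C(I, ℝ)) (s : Finset (Fin N)) : ℝ :=
  (∫ ω, innerPairTerm p s (Y ω) ∂P)
    - (∑ k ∈ s, (∏ j ∈ s.erase k, f (site j)) * densityOp p f (site k)
      - corrOp p s (fun s => ∏ k ∈ s, f (site k)))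

theorem IsHydrodynamicDensity.eventually_abs_riemannSum_pairGrowth_sub_le
    (hρ : IsHydrodynamicDensity p φ ρ) (T : ℝ≥0) {ε : ℝ} (hε : 0 < ε) :
    ∀ᶠ N : ℕ in atTop, ∀ t : ℝ≥0, t ≤ T → ∀ u : I,
      |(1 / (N : ℝ)) * ∑ j : Fin N, pairGrowth p (ρ t) u (site j)
        - ∫ v : I, pairGrowth p (ρ t) u v| ≤ ε := by
  have hcont : Continuous (Function.uncurry fun (y : Set.Icc (0 : ℝ≥0) T × I) (v : I) =>
      pairGrowth p (ρ (y.1 : ℝ≥0)) y.2 v) := by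
    have hdens : Continuous fun z : (Set.Icc (0 : ℝ≥0) T × I) × I => ρ (z.1.1 : ℝ≥0) :=
      hρ.continuous.comp (by fun_prop)
    have hsites : Continuous fun z : (Set.Icc (0 : ℝ≥0) T × I) × I => (z.1.2, z.2) := by fun_prop
    exact (((continuous_selfRate p).comp hsites).mul (hdens.eval (by fun_prop))).add
      (((continuous_crossRate p).comp hsites).mul (hdens.eval (by fun_prop)))
  filter_upwards [eventually_abs_riemannSum_sub_integral_le hcont hε] with N hN t ht u
  exact hN (⟨t, zero_le, ht⟩, u)

section FixedSize

variable {N : ℕ} {Ω : Type*} [MeasurableSpace Ω] {P : Measure Ω} [IsProbabilityMeasure P]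
  {X : ℝ≥0 → Ω → (Fin N → ℝ≥0)}

theorem IsUrnLinearSystem.hasDerivWithinAt_correlationError (hX : IsUrnLinearSystem p N P X)
    (h₁ : ∀ᵐ ω ∂P, ∀ k, X 0 ω k ≤ 1) (hρ : IsHydrodynamicDensity p φ ρ) (s : Finset (Fin N))
    {t : ℝ} (ht : 0 ≤ t) :
    HasDerivWithinAt (fun t : ℝ => correlationError P (X t.toNNReal) (ρ t) s)
      (corrOp p s (correlationError P (X t.toNNReal) (ρ t))
        + correlationDefect p P (X t.toNNReal) (ρ t) s) (Set.Ici 0) t := by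
  have hsub : correlationError P (X t.toNNReal) (ρ t)
      = correlation P (X t.toNNReal) - fun s => ∏ k ∈ s, ρ t (site k) := rfl
  refine ((hX.hasDerivWithinAt_correlation h₁ s ht).sub
    (hρ.hasDerivWithinAt_prod s ht)).congr_deriv ?_
  rw [hsub, map_sub, correlationDefect]
  ring

theorem IsUrnLinearSystem.abs_correlationError_le (hX : IsUrnLinearSystem p N P X)
    (hA : InitialAssumption φ N P (X 0)) (hρ : IsHydrodynamicDensity p φ ρ) (hK : p.IsBound K)
    {T : ℝ≥0} {n : ℕ} {η : ℝ} (hη : ∀ t ≤ T, ∀ s : Finset (Fin N), s.card = n →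
      |correlationDefect p P (X t) (ρ t) s| ≤ η) {t : ℝ≥0} (ht : t ≤ T) {s : Finset (Fin N)}
    (hs : s.card = n) :
    |correlationError P (X t) (ρ t) s| ≤ gronwallBound 0 (5 * n * K ^ 2) η t := by
  have hη₀ : 0 ≤ η := (abs_nonneg _).trans (hη t ht s hs)
  have h₁ := hA.ae_le_one (hX.measurable 0)
  let err : ℝ → {s : Finset (Fin N) // s.card = n} → ℝ := fun t s =>
    correlationError P (X t.toNNReal) (ρ t) s
  have hinit : ‖err 0‖ ≤ 0 := by
    refine (pi_norm_le_iff_of_nonneg le_rfl).2 fun s => ?_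
    simp only [err, correlationError, correlation, Real.toNNReal_zero, hρ.initial,
      hA.integral_prod (hX.measurable 0), sub_self, norm_zero, le_refl]
  have hgronwall := norm_le_gronwallBound (f := err) (C := 5 * n * K ^ 2) (ε := η) (T := T)
    (fun t ht => hasDerivWithinAt_pi.2 fun s : {s : Finset (Fin N) // s.card = n} =>
      hX.hasDerivWithinAt_correlationError h₁ hρ s ht) hinit
    (fun r hr => (pi_norm_le_iff_of_nonneg (by positivity)).2 fun s => ?_) ⟨t.2, ht⟩
  · exact (by simpa [err] using norm_le_pi_norm (err t) ⟨s, hs⟩ : _ ≤ ‖err t‖).trans hgronwall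
  · have hop := hK.abs_corrOp_le (s := s.1) (B := ‖err r‖)
      (w := correlationError P (X r.toNNReal) (ρ r)) fun s' hs' =>
        norm_le_pi_norm (err r) ⟨s', hs'.trans s.2⟩
    have hdefect := hη r.toNNReal (Real.toNNReal_le_iff_le_coe.2 hr.2.le) s s.2
    rw [Real.coe_toNNReal r hr.1] at hdefect
    rw [s.2] at hop
    exact (abs_add_le _ _).trans (add_le_add hop hdefect)

end FixedSize

variable {Ω : ℕ → Type*} [∀ N, MeasurableSpace (Ω N)] {P : ∀ N, Measure (Ω N)}
  [∀ N, IsProbabilityMeasure (P N)] {X : ∀ N, ℝ≥0 → Ω N → (Fin N → ℝ≥0)}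

theorem eventually_abs_correlationDefect_le (hX : ∀ N, IsUrnLinearSystem p N (P N) (X N))
    (h₁ : ∀ N, ∀ᵐ ω ∂P N, ∀ k, X N 0 ω k ≤ 1) (hρ : IsHydrodynamicDensity p φ ρ) (T : ℝ≥0)
    (n : ℕ) {η : ℝ} (hη : 0 < η) :
    ∀ᶠ N : ℕ in atTop, ∀ t ≤ T, ∀ s : Finset (Fin N), s.card = n →
      |correlationDefect p (P N) (X N t) (ρ t) s| ≤ η := by
  obtain ⟨K, hK⟩ := p.exists_isBound
  obtain ⟨R, hR, hρR⟩ := hρ.exists_bound T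
  have hK₀ := hK.nonneg
  let M : ℝ := n ^ 4 * K * (2 * K) ^ n * Real.exp (6 * K * (2 * K) ^ n * T)
  have hlim : Tendsto (fun x : ℝ => x * M + n * (R ^ n * (x + x * (n * (4 * K ^ 2 * R)))))
      (𝓝 0) (𝓝 0) := by
    have hcont : Continuous fun x : ℝ =>
      x * M + n * (R ^ n * (x + x * (n * (4 * K ^ 2 * R)))) := by fun_prop
    simpa using hcont.tendsto 0
  obtain ⟨ε, hε, hεη⟩ := (((hlim.mono_left nhdsWithin_le_nhds).eventually
    (gt_mem_nhds hη)).and (self_mem_nhdsWithin (s := Set.Ioi 0))).exists.imp fun _ h => h.symm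
  have hinv := (tendsto_one_div_atTop_nhds_zero_nat (𝕜 := ℝ)).eventually (gt_mem_nhds hε)
  filter_upwards [hρ.eventually_abs_riemannSum_pairGrowth_sub_le T hε, hinv]
    with N hriemann hN t ht s hs
  calc |correlationDefect p (P N) (X N t) (ρ t) s|
      ≤ (1 / (N : ℝ)) * M + n * (R ^ n * (ε + (1 / (N : ℝ)) * (n * (4 * K ^ 2 * R)))) := by
        refine (abs_sub _ _).trans (add_le_add ?_ ?_)
        · refine ((hX N).abs_integral_innerPairTerm_le (h₁ N) hK t s).trans ?_
          rw [hs]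
          simp only [M]
          gcongr
        · simpa only [hs] using
            hK.abs_prod_density_sub_corrOp_le hR (hρR t ht) (hriemann t ht) s
    _ ≤ ε * M + n * (R ^ n * (ε + ε * (n * (4 * K ^ 2 * R)))) := by gcongr
    _ ≤ η := hεη.le

theorem eventually_abs_correlationError_le (hX : ∀ N, IsUrnLinearSystem p N (P N) (X N))
    (hA : ∀ N, InitialAssumption φ N (P N) (X N 0)) (hρ : IsHydrodynamicDensity p φ ρ) (T : ℝ≥0)
    (n : ℕ) {ε : ℝ} (hε : 0 < ε) :
    ∀ᶠ N : ℕ in atTop, ∀ t ≤ T, ∀ s : Finset (Fin N), s.card = n →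
      |correlationError (P N) (X N t) (ρ t) s| ≤ ε := by
  obtain ⟨K, hK⟩ := p.exists_isBound
  have hlim : Tendsto (fun η => gronwallBound 0 (5 * n * K ^ 2) η T) (𝓝 0) (𝓝 0) := by
    simpa only [gronwallBound_ε0_δ0] using
      (gronwallBound_continuous_ε 0 (5 * n * K ^ 2) (T : ℝ)).tendsto 0
  obtain ⟨η, hη, hηε⟩ := (((hlim.mono_left nhdsWithin_le_nhds).eventually
    (gt_mem_nhds hε)).and (self_mem_nhdsWithin (s := Set.Ioi 0))).exists.imp fun _ h => h.symm
  filter_upwards [eventually_abs_correlationDefect_le hX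
    (fun N => (hA N).ae_le_one ((hX N).measurable 0)) hρ T n hη] with N hN t ht s hs
  calc |correlationError (P N) (X N t) (ρ t) s| ≤ gronwallBound 0 (5 * n * K ^ 2) η t :=
        (hX N).abs_correlationError_le (hA N) hρ hK hN ht hs
    _ ≤ gronwallBound 0 (5 * n * K ^ 2) η T :=
        gronwallBound_mono le_rfl hη.le (by positivity) (NNReal.coe_le_coe.2 ht)
    _ ≤ ε := hηε.le

end Chaos

section Moments

variable {ι : Type*} [Fintype ι] {p : Coeffs}

namespace IsUrnLinearSystem

variable {N : ℕ} {Ω : Type*} [MeasurableSpace Ω] {P : Measure Ω} [IsProbabilityMeasure P]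
  {X : ℝ≥0 → Ω → (Fin N → ℝ≥0)} (hX : IsUrnLinearSystem p N P X) (h₁ : ∀ᵐ ω ∂P, ∀ k, X 0 ω k ≤ 1)
include hX h₁

theorem integrable_prod (t : ℝ≥0) (m : ι → Fin N) :
    Integrable (fun ω => ∏ l, (X t ω (m l) : ℝ)) P := by
  rcases isEmpty_or_nonempty ι with h | h
  · simp only [Finset.univ_eq_empty, Finset.prod_empty, integrable_const]
  · have hmeas : Measurable fun x : Fin N → ℝ≥0 => ∏ l, (x (m l) : ℝ) := by fun_prop
    refine (integrable_finsetSum Finset.univ fun l _ =>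
      hX.integrable_pow h₁ (Finset.univ : Finset ι).card t (m l)).mono'
      (hmeas.comp (hX.measurable t)).aestronglyMeasurable (ae_of_all _ fun ω => ?_)
    rw [Real.norm_of_nonneg (by positivity)]
    exact prod_le_sum_pow_card Finset.univ_nonempty _

theorem integral_prod_le [Nonempty ι] {K : ℝ} (hK : p.IsBound K) (t : ℝ≥0) (m : ι → Fin N) :
    ∫ ω, ∏ l, (X t ω (m l) : ℝ) ∂P
      ≤ Fintype.card ι * Real.exp (6 * K * (2 * K) ^ Fintype.card ι * t) := by
  have hpow := fun l => hX.integrable_pow h₁ (Fintype.card ι) t (m l)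
  calc _ ≤ ∫ ω, ∑ l, (X t ω (m l) : ℝ) ^ Fintype.card ι ∂P :=
        integral_mono (hX.integrable_prod h₁ t m) (integrable_finsetSum _ fun l _ => hpow l)
          fun ω => prod_le_sum_pow_card Finset.univ_nonempty fun l => X t ω (m l)
    _ ≤ ∑ _l : ι, Real.exp (6 * K * (2 * K) ^ Fintype.card ι * t) := by
        rw [integral_finsetSum _ fun l _ => hpow l]
        exact Finset.sum_le_sum fun l _ => hX.integral_pow_le hK h₁ _ t (m l)
    _ = _ := by rw [Finset.sum_const, Finset.card_univ, nsmul_eq_mul]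

end IsUrnLinearSystem

theorem exists_abs_integral_prod_sub_prod_le [Nonempty ι] {φ : C(I, ℝ)} {ρ : ℝ → C(I, ℝ)}
    {Ω : ℕ → Type*} [∀ N, MeasurableSpace (Ω N)] {P : ∀ N, Measure (Ω N)}
    [∀ N, IsProbabilityMeasure (P N)] {X : ∀ N, ℝ≥0 → Ω N → (Fin N → ℝ≥0)}
    (hX : ∀ N, IsUrnLinearSystem p N (P N) (X N)) (h₁ : ∀ N, ∀ᵐ ω ∂P N, ∀ k, X N 0 ω k ≤ 1)
    (hρ : IsHydrodynamicDensity p φ ρ) (T : ℝ≥0) :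
    ∃ M : ℝ, ∀ N, ∀ t ≤ T, ∀ m : ι → Fin N,
      |∫ ω, ∏ l, (X N t ω (m l) : ℝ) ∂P N - ∏ l, ρ t (site (m l))| ≤ M := by
  obtain ⟨K, hK⟩ := p.exists_isBound
  obtain ⟨R, -, hρR⟩ := hρ.exists_bound T
  have hK₀ := hK.nonneg
  refine ⟨Fintype.card ι * Real.exp (6 * K * (2 * K) ^ Fintype.card ι * T)
    + R ^ Fintype.card ι, fun N t ht m => (abs_sub _ _).trans (add_le_add ?_ ?_)⟩
  · rw [abs_of_nonneg (integral_nonneg fun ω => by positivity)]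
    refine ((hX N).integral_prod_le (h₁ N) hK t m).trans ?_
    gcongr
  · rw [Finset.abs_prod]
    exact (Finset.prod_le_prod (fun _ _ => abs_nonneg _) fun l _ => hρR t ht _).trans_eq
      (Finset.prod_const R)

end Moments

section VStatistic

open scoped BigOperators

variable {ι : Type*} [Fintype ι] [DecidableEq ι]

/-- The V-statistic of a configuration `y` with kernel `G`: the average of
`G(m(l)/N : l ∈ ι) ∏ₗ y(m(l))` over all maps `m : ι → {1, …, N}`, injective or not. It integrates
`G` against the `ι`-th power of the empirical measure `N⁻¹ ∑ᵢ y(i) δ_{i/N}`. -/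
noncomputable def vStat {N : ℕ} (G : (ι → I) → ℝ) (y : Fin N → ℝ) : ℝ :=
  𝔼 m : ι → Fin N, G (fun l => site (m l)) * ∏ l, y (m l)

theorem vStat_mul_vStat {κ : Type*} [Fintype κ] [DecidableEq κ] {N : ℕ} (G : (ι → I) → ℝ)
    (H : (κ → I) → ℝ) (y : Fin N → ℝ) : vStat G y * vStat H y
      = vStat (fun z : ι ⊕ κ → I => G (fun l => z (.inl l)) * H (fun l => z (.inr l))) y := by
  unfold vStat
  rw [Finset.expect_mul_expect, ← Finset.expect_product', Finset.univ_product_univ]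
  refine (Fintype.expect_equiv (Equiv.sumArrowEquivProdArrow ι κ (Fin N)) _ _ fun m => ?_).symm
  rw [Fintype.prod_sum_type]
  exact mul_mul_mul_comm _ _ _ _

theorem abs_vStat_le {N : ℕ} {G : (ι → I) → ℝ} {y : Fin N → ℝ} {B R : ℝ} (hB : 0 ≤ B)
    (hG : ∀ z, |G z| ≤ B) (hR : 0 ≤ R) (hy : ∀ k, |y k| ≤ R) :
    |vStat G y| ≤ B * R ^ Fintype.card ι := by
  have hterm : ∀ m : ι → Fin N,
      |G (fun l => site (m l)) * ∏ l, y (m l)| ≤ B * R ^ Fintype.card ι := fun m => by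
    rw [abs_mul, Finset.abs_prod]
    refine mul_le_mul (hG _) ?_ (by positivity) hB
    exact (Finset.prod_le_prod (fun _ _ => abs_nonneg _) fun l _ => hy (m l)).trans_eq
      (Finset.prod_const R)
  rcases isEmpty_or_nonempty (ι → Fin N) with h | h
  · rw [vStat, Finset.univ_eq_empty, Finset.expect_empty, abs_zero]
    positivity
  · exact (Finset.abs_expect_le _ _).trans
      (Finset.expect_le Finset.univ_nonempty fun m _ => hterm m)

theorem expect_ite_injective (N : ℕ) :
    𝔼 m : ι → Fin N, (if Function.Injective m then (1 : ℝ) else 0)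
      = N.descFactorial (Fintype.card ι) / (N : ℝ) ^ Fintype.card ι := by
  have hcard := Fintype.card_congr (Equiv.subtypeInjectiveEquivEmbedding ι (Fin N))
  rw [Fintype.card_subtype, Fintype.card_embedding_eq, Fintype.card_fin] at hcard
  rw [Fintype.expect_eq_sum_div_card, Finset.sum_boole, hcard, Fintype.card_fun, Fintype.card_fin,
    Nat.cast_pow]

theorem tendsto_descFactorial_div_pow (n : ℕ) :
    Tendsto (fun N : ℕ => (N.descFactorial n : ℝ) / (N : ℝ) ^ n) atTop (𝓝 1) :=
  (Asymptotics.isEquivalent_iff_tendsto_one (by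
    filter_upwards [eventually_gt_atTop 0] with N hN
    positivity)).1 (isEquivalent_descFactorial n)

section RandomConfiguration

variable {N : ℕ} {Ω : Type*} [MeasurableSpace Ω] {P : Measure Ω} {Y : Ω → (Fin N → ℝ≥0)}

theorem integrable_vStat
    (hint : ∀ m : ι → Fin N, Integrable (fun ω => ∏ l, (Y ω (m l) : ℝ)) P) (G : (ι → I) → ℝ) :
    Integrable (fun ω => vStat G fun k => (Y ω k : ℝ)) P := by
  simp only [vStat, Fintype.expect_eq_sum_div_card]
  exact (integrable_finsetSum _ fun m _ => (hint m).const_mul _).div_const _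

theorem integral_vStat
    (hint : ∀ m : ι → Fin N, Integrable (fun ω => ∏ l, (Y ω (m l) : ℝ)) P) (G : (ι → I) → ℝ) :
    ∫ ω, vStat G (fun k => (Y ω k : ℝ)) ∂P
      = 𝔼 m : ι → Fin N, G (fun l => site (m l)) * ∫ ω, ∏ l, (Y ω (m l) : ℝ) ∂P := by
  simp only [vStat, Fintype.expect_eq_sum_div_card]
  rw [integral_div, integral_finsetSum _ fun m _ => (hint m).const_mul _]
  simp only [integral_const_mul]

theorem abs_integral_vStat_sub_le [NeZero N]
    (hint : ∀ m : ι → Fin N, Integrable (fun ω => ∏ l, (Y ω (m l) : ℝ)) P) {f : I → ℝ}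
    {ε M B : ℝ} (hε : ∀ s, s.card = Fintype.card ι → |correlationError P Y f s| ≤ ε)
    (hε₀ : 0 ≤ ε) (hM : ∀ m : ι → Fin N, ¬Function.Injective m →
      |∫ ω, ∏ l, (Y ω (m l) : ℝ) ∂P - ∏ l, f (site (m l))| ≤ M)
    {G : (ι → I) → ℝ} (hG : ∀ z, |G z| ≤ B) :
    |∫ ω, vStat G (fun k => (Y ω k : ℝ)) ∂P - vStat G (fun k : Fin N => f (site k))| ≤ B * (ε + M *
      (1 - N.descFactorial (Fintype.card ι) / (N : ℝ) ^ Fintype.card ι)) := by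
  have hB : 0 ≤ B := (abs_nonneg _).trans (hG fun _ => 0)
  have hdiff : ∀ m : ι → Fin N, |∫ ω, ∏ l, (Y ω (m l) : ℝ) ∂P - ∏ l, f (site (m l))|
      ≤ ε + M * (1 - if Function.Injective m then 1 else 0) := fun m => by
    split_ifs with hm
    · rw [sub_self, mul_zero, add_zero]
      simpa only [correlationError, correlation, Finset.prod_map, Function.Embedding.coeFn_mk]
        using hε (Finset.univ.map ⟨m, hm⟩) (by rw [Finset.card_map, Finset.card_univ])
    · rw [sub_zero, mul_one]
      exact (hM m hm).trans (le_add_of_nonneg_left hε₀)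
  calc _ = |𝔼 m : ι → Fin N, G (fun l => site (m l)) *
        (∫ ω, ∏ l, (Y ω (m l) : ℝ) ∂P - ∏ l, f (site (m l)))| := by
        rw [integral_vStat hint, vStat, ← Finset.expect_sub_distrib]
        simp only [mul_sub]
    _ ≤ 𝔼 m : ι → Fin N, B * (ε + M * (1 - if Function.Injective m then 1 else 0)) := by
        refine (Finset.abs_expect_le _ _).trans (Finset.expect_le_expect fun m _ => ?_)
        rw [abs_mul]
        exact mul_le_mul (hG _) (hdiff m) (abs_nonneg _) hB
    _ = _ := by
        rw [← Finset.mul_expect, Finset.expect_add_distrib, ← Finset.mul_expect,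
          Finset.expect_sub_distrib, Fintype.expect_const, Fintype.expect_const,
          expect_ite_injective]

section SecondMoment

variable (hint : ∀ m : ι → Fin N, Integrable (fun ω => ∏ l, (Y ω (m l) : ℝ)) P)
  (hint₂ : ∀ m : ι ⊕ ι → Fin N, Integrable (fun ω => ∏ l, (Y ω (m l) : ℝ)) P)
include hint hint₂

theorem integrable_sq_vStat_sub [IsFiniteMeasure P] (G : (ι → I) → ℝ) (v : ℝ) :
    Integrable (fun ω => (vStat G (fun k => (Y ω k : ℝ)) - v) ^ 2) P := by
  simp only [sub_sq, sq (vStat _ _), vStat_mul_vStat]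
  exact ((integrable_vStat hint₂ _).sub (((integrable_vStat hint G).const_mul 2).mul_const v)).add
    (integrable_const _)

theorem integral_sq_vStat_sub [IsProbabilityMeasure P] (G : (ι → I) → ℝ) (y : Fin N → ℝ) :
    ∫ ω, (vStat G (fun k => (Y ω k : ℝ)) - vStat G y) ^ 2 ∂P
      = (∫ ω, vStat (fun z : ι ⊕ ι → I => G (fun l => z (.inl l)) * G (fun l => z (.inr l)))
            (fun k => (Y ω k : ℝ)) ∂P
          - vStat (fun z : ι ⊕ ι → I => G (fun l => z (.inl l)) * G (fun l => z (.inr l))) y)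
        - 2 * vStat G y * (∫ ω, vStat G (fun k => (Y ω k : ℝ)) ∂P - vStat G y) := by
  have h₁ := integrable_vStat hint G
  have h₂ := integrable_vStat hint₂ fun z => G (fun l => z (.inl l)) * G (fun l => z (.inr l))
  have h₃ := (h₁.const_mul 2).mul_const (vStat G y)
  simp only [← vStat_mul_vStat] at h₂ ⊢
  have h₄ : Integrable (fun ω => vStat G (fun k => (Y ω k : ℝ)) * vStat G (fun k => (Y ω k : ℝ))
      - 2 * vStat G (fun k => (Y ω k : ℝ)) * vStat G y) P := h₂.sub h₃
  simp only [sub_sq, sq (vStat _ _)]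
  rw [integral_add h₄ (integrable_const _), integral_sub h₂ h₃, integral_mul_const,
    integral_const_mul, integral_const, probReal_univ, one_smul]
  ring

end SecondMoment

end RandomConfiguration

variable {p : Coeffs} {φ : C(I, ℝ)} {ρ : ℝ → C(I, ℝ)} {Ω : ℕ → Type*}
  [∀ N, MeasurableSpace (Ω N)] {P : ∀ N, Measure (Ω N)} [∀ N, IsProbabilityMeasure (P N)]
  {X : ∀ N, ℝ≥0 → Ω N → (Fin N → ℝ≥0)}

theorem eventually_abs_integral_vStat_sub_le [Nonempty ι]
    (hX : ∀ N, IsUrnLinearSystem p N (P N) (X N))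
    (hA : ∀ N, InitialAssumption φ N (P N) (X N 0)) (hρ : IsHydrodynamicDensity p φ ρ) (T : ℝ≥0)
    (B : ℝ) {ε : ℝ} (hε : 0 < ε) :
    ∀ᶠ N : ℕ in atTop, ∀ t ≤ T, ∀ G : (ι → I) → ℝ, (∀ z, |G z| ≤ B) →
      |∫ ω, vStat G (fun k => (X N t ω k : ℝ)) ∂P N
        - vStat G (fun k : Fin N => ρ t (site k))| ≤ ε := by
  have h₁ : ∀ N, ∀ᵐ ω ∂P N, ∀ k, X N 0 ω k ≤ 1 := fun N => (hA N).ae_le_one ((hX N).measurable 0)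
  obtain ⟨M, hM⟩ := exists_abs_integral_prod_sub_prod_le (ι := ι) hX h₁ hρ T
  obtain ⟨δ, hδε, hδ⟩ : ∃ δ, B * δ < ε ∧ 0 < δ := by
    have hlim : Tendsto (fun δ => B * δ) (𝓝 0) (𝓝 0) :=
      (continuous_const_mul B).tendsto' 0 0 (mul_zero B)
    exact (((hlim.mono_left nhdsWithin_le_nhds).eventually (gt_mem_nhds hε)).and
      (self_mem_nhdsWithin (s := Set.Ioi 0))).exists
  have hlim : Tendsto (fun N : ℕ => B * (δ + M *
      (1 - N.descFactorial (Fintype.card ι) / (N : ℝ) ^ Fintype.card ι))) atTop (𝓝 (B * δ)) := by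
    simpa using ((((tendsto_descFactorial_div_pow (Fintype.card ι)).const_sub 1).const_mul
      M).const_add δ).const_mul B
  filter_upwards [eventually_abs_correlationError_le hX hA hρ T (Fintype.card ι) hδ,
    hlim.eventually (gt_mem_nhds hδε), eventually_ne_atTop 0] with N hcorr hN hN₀ t ht G hG
  have : NeZero N := ⟨hN₀⟩
  exact (abs_integral_vStat_sub_le ((hX N).integrable_prod (h₁ N) t) (hcorr t ht) hδ.le
    (fun m _ => hM N t ht m) hG).trans hN.le

theorem eventually_integral_sq_vStat_sub_le [Nonempty ι]
    (hX : ∀ N, IsUrnLinearSystem p N (P N) (X N))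
    (hA : ∀ N, InitialAssumption φ N (P N) (X N 0)) (hρ : IsHydrodynamicDensity p φ ρ) (T : ℝ≥0)
    (B : ℝ) {ε : ℝ} (hε : 0 < ε) :
    ∀ᶠ N : ℕ in atTop, ∀ t ≤ T, ∀ G : (ι → I) → ℝ, (∀ z, |G z| ≤ B) →
      Integrable (fun ω => (vStat G (fun k => (X N t ω k : ℝ))
        - vStat G (fun k : Fin N => ρ t (site k))) ^ 2) (P N) ∧
      ∫ ω, (vStat G (fun k => (X N t ω k : ℝ)) - vStat G (fun k : Fin N => ρ t (site k))) ^ 2 ∂P N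
        ≤ ε := by
  have h₁ : ∀ N, ∀ᵐ ω ∂P N, ∀ k, X N 0 ω k ≤ 1 := fun N => (hA N).ae_le_one ((hX N).measurable 0)
  obtain ⟨R, hR, hρR⟩ := hρ.exists_bound T
  let V : ℝ := |B| * R ^ Fintype.card ι
  have hV : 0 < 1 + V := by positivity
  have hδ : 0 < ε / (4 * (1 + V)) := by positivity
  filter_upwards [
    eventually_abs_integral_vStat_sub_le hX hA hρ T (ι := ι ⊕ ι) (B * B) (half_pos hε),
    eventually_abs_integral_vStat_sub_le hX hA hρ T (ι := ι) B hδ] with N hpair hsingle t ht G hG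
  have hint := (hX N).integrable_prod (ι := ι) (h₁ N) t
  have hint₂ := (hX N).integrable_prod (ι := ι ⊕ ι) (h₁ N) t
  refine ⟨integrable_sq_vStat_sub hint hint₂ G _, ?_⟩
  have hB : 0 ≤ B := (abs_nonneg _).trans (hG fun _ => 0)
  have hv : |vStat G fun k : Fin N => ρ t (site k)| ≤ 1 + V := by
    have := abs_vStat_le (abs_nonneg B) (fun z => (hG z).trans (le_abs_self B))
      (zero_le_one.trans hR) fun k : Fin N => hρR t ht (site k)
    linarith
  rw [integral_sq_vStat_sub hint hint₂]
  calc _ ≤ ε / 2 + 2 * (1 + V) * (ε / (4 * (1 + V))) := by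
        refine (le_abs_self _).trans ((abs_sub _ _).trans (add_le_add
          (hpair t ht _ fun z => ?_) ?_))
        · rw [abs_mul]
          exact mul_le_mul (hG _) (hG _) (abs_nonneg _) hB
        · rw [abs_mul, abs_mul, abs_two]
          gcongr
          exact hsingle t ht G hG
    _ = ε := by field_simp; ring

end VStatistic

section PairEmpirical

theorem vStat_fin_two {N : ℕ} (h : I × I → ℝ) (y : Fin N → ℝ) :
    vStat (fun z : Fin 2 → I => h (z 0, z 1)) y
      = ((N : ℝ) ^ 2)⁻¹ * ∑ i, ∑ j, y i * y j * h (site i, site j) := by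
  rw [vStat, Fintype.expect_eq_sum_div_card, Fintype.card_fun, Fintype.card_fin, Fintype.card_fin,
    Nat.cast_pow, div_eq_inv_mul, ← Fintype.sum_prod_type',
    ← (finTwoArrowEquiv (Fin N)).sum_comp]
  congr 1
  exact Finset.sum_congr rfl fun m _ => by
    rw [Fin.prod_univ_two, mul_comm]
    rfl

theorem integral_pairEmpirical {N : ℕ} (h : I × I → ℝ) (x : Fin N → ℝ≥0) :
    ∫ z, h z ∂(pairEmpirical x)
      = vStat (fun z : Fin 2 → I => h (z 0, z 1)) fun k => (x k : ℝ) := by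
  have hatom : ∀ i j : Fin N,
      Integrable h ((x i * x j) • Measure.dirac ((site i, site j) : I × I)) := fun i j =>
    (integrable_dirac enorm_lt_top).smul_measure_nnreal
  rw [vStat_fin_two, pairEmpirical, integral_smul_nnreal_measure,
    integral_finsetSum_measure fun i _ => integrable_finsetSum_measure.2 fun j _ => hatom i j]
  simp only [integral_finsetSum_measure fun j _ => hatom _ j, integral_smul_nnreal_measure,
    integral_dirac, NNReal.smul_def, smul_eq_mul, NNReal.coe_inv, NNReal.coe_pow,
    NNReal.coe_natCast, NNReal.coe_mul]

theorem IsHydrodynamicDensity.eventually_abs_vStat_sub_integral_le {p : Coeffs} {φ : C(I, ℝ)}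
    {ρ : ℝ → C(I, ℝ)} (hρ : IsHydrodynamicDensity p φ ρ) {T : ℝ≥0}
    (H : C(Set.Icc (0 : ℝ≥0) T × I × I, ℝ)) {ε : ℝ} (hε : 0 < ε) :
    ∀ᶠ N : ℕ in atTop, ∀ t : Set.Icc (0 : ℝ≥0) T,
      |vStat (fun z : Fin 2 → I => H (t, z 0, z 1)) (fun k : Fin N => ρ (t : ℝ≥0) (site k))
        - ∫ u : I, ∫ v : I, ρ (t : ℝ≥0) u * ρ (t : ℝ≥0) v * H (t, u, v)| ≤ ε := by
  have hcont : Continuous fun z : (Set.Icc (0 : ℝ≥0) T × I) × I =>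
      ρ (z.1.1 : ℝ≥0) z.1.2 * ρ (z.1.1 : ℝ≥0) z.2 * H (z.1.1, z.1.2, z.2) := by
    have hdens : Continuous fun z : (Set.Icc (0 : ℝ≥0) T × I) × I => ρ (z.1.1 : ℝ≥0) :=
      hρ.continuous.comp (by fun_prop)
    exact ((hdens.eval (by fun_prop)).mul (hdens.eval (by fun_prop))).mul (by fun_prop)
  filter_upwards [eventually_abs_riemannSum_sub_integral_integral_le
    (F := fun (t : Set.Icc (0 : ℝ≥0) T) u v => ρ (t : ℝ≥0) u * ρ (t : ℝ≥0) v * H (t, u, v))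
    hcont hε] with N hN t
  rw [vStat_fin_two fun z => H (t, z)]
  simpa only [one_div, ← Finset.mul_sum, ← mul_assoc, ← sq, inv_pow] using hN t

end PairEmpirical

theorem lintegral_ofReal_sq_sub_le {Ω : Type*} [MeasurableSpace Ω] {P : Measure Ω}
    [IsProbabilityMeasure P] {U : Ω → ℝ} {a : ℝ} (hU : Integrable (fun ω => (U ω - a) ^ 2) P)
    (b : ℝ) :
    ∫⁻ ω, ENNReal.ofReal ((U ω - b) ^ 2) ∂P
      ≤ ENNReal.ofReal (2 * (∫ ω, (U ω - a) ^ 2 ∂P + (a - b) ^ 2)) := by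
  have hsum : Integrable (fun ω => 2 * ((U ω - a) ^ 2 + (a - b) ^ 2)) P :=
    (hU.add (integrable_const _)).const_mul 2
  calc ∫⁻ ω, ENNReal.ofReal ((U ω - b) ^ 2) ∂P
      ≤ ∫⁻ ω, ENNReal.ofReal (2 * ((U ω - a) ^ 2 + (a - b) ^ 2)) ∂P := by
        refine lintegral_mono fun ω => ENNReal.ofReal_le_ofReal ?_
        simpa only [sub_add_sub_cancel] using add_sq_le (a := U ω - a) (b := a - b)
    _ = ENNReal.ofReal (2 * (∫ ω, (U ω - a) ^ 2 ∂P + (a - b) ^ 2)) := by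
        rw [← ofReal_integral_eq_lintegral_ofReal hsum (ae_of_all _ fun ω => by positivity),
          integral_const_mul, integral_add hU (integrable_const _), integral_const,
          probReal_univ, one_smul]

end UrnSystem

theorem lemma2p4 (p : UrnSystem.Coeffs) (φ : C(I, ℝ))
    {Ω : ℕ → Type*} [∀ N, MeasurableSpace (Ω N)]
    (P : ∀ N, Measure (Ω N)) [∀ N, IsProbabilityMeasure (P N)]
    (X : ∀ N, ℝ≥0 → Ω N → (Fin N → ℝ≥0))
    (hX : ∀ N, UrnSystem.IsUrnLinearSystem p N (P N) (X N))
    (hA : ∀ N, UrnSystem.InitialAssumption φ N (P N) (X N 0))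
    (ρ : ℝ → C(I, ℝ)) (hρ : UrnSystem.IsHydrodynamicDensity p φ ρ)
    (T : ℝ≥0) (hT : 0 < T) (H : C(Set.Icc (0 : ℝ≥0) T × I × I, ℝ)) :
    Tendsto
      (fun N : ℕ => ⨆ t : Set.Icc (0 : ℝ≥0) T,
        ∫⁻ ω, ENNReal.ofReal
          (((∫ z, H (t, z) ∂(UrnSystem.pairEmpirical (X N t ω))) -
            ∫ u : I, ∫ v : I, ρ ((t : ℝ≥0) : ℝ) u * ρ ((t : ℝ≥0) : ℝ) v * H (t, u, v)) ^ 2) ∂(P N))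
      atTop (𝓝 0) := by
  refine ENNReal.tendsto_nhds_zero.2 fun ε hε => ?_
  obtain ⟨δ, hδ, hδε⟩ := ENNReal.lt_iff_exists_nnreal_btwn.1 hε
  have hδ₄ : (0 : ℝ) < δ / 4 := div_pos (by exact_mod_cast hδ) four_pos
  filter_upwards [
    UrnSystem.eventually_integral_sq_vStat_sub_le (ι := Fin 2) hX hA hρ T ‖H‖ hδ₄,
    hρ.eventually_abs_vStat_sub_integral_le H (Real.sqrt_pos.2 hδ₄)] with N hfluct hriemann
  refine (iSup_le fun t => ?_ : _ ≤ (δ : ℝ≥0∞)).trans hδε.le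
  obtain ⟨hint, hvar⟩ := hfluct t t.2.2 (fun z => H (t, z 0, z 1)) fun z => H.norm_coe_le_norm _
  have hbias := (Real.sq_le hδ₄.le).2 (abs_le.1 (hriemann t))
  simp only [UrnSystem.integral_pairEmpirical fun z => H (t, z)]
  refine (UrnSystem.lintegral_ofReal_sq_sub_le hint _).trans ?_
  rw [← ENNReal.ofReal_coe_nnreal]
  exact ENNReal.ofReal_le_ofReal (by linarith)
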